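/- Let $(M,g)$ be a smooth Lorentzian manifold of dimension $n\ge 2$ (signature $(-,+,\dots,+)$), let $\gamma:D\to M$ be a null geodesic defined on an open interval $D\subseteq\mathbb R$ (so $\dot\gamma$ is nonzero and null), let $J\subseteq D$ be an interval such that $\gamma' = \gamma|_J$ is free of conjugate points (no two distinct parameters $s,t\in J$ admit a Jacobi field along $\gamma$ that is not identically zero and vanishes at both $s$ and $t$), and let $t_0\in J$. Then there is a smooth chart $\psi=(u,v,x^1,\dots,x^{n-2})$ of $M$ on an open neighbourhood $U$ of the point $\gamma(t_0)$, with $\psi(\gamma(t_0))=0$ ("null coordinates"), such that on $U$ $$g = 2\,du\,dv+H\,du^{2}+2A_a\,dx^a\,du+g_{ab}\,dx^a\,dx^b ,\qquad a,b\in\{1,\dots,n-2\},$$ where $H$, $A_a$ and $g_{ab}$ are smooth functions of the coordinates and the matrix $(g_{ab})$ is positive definite. Moreover, in these coordinates $\gamma$ is the integral curve of $\partial_v$ through the origin: $\dot\gamma(t)=\partial_v|_{\gamma(t)}$ for all $t\in D$ such that $\gamma$ maps the closed interval between $t_0$ and $t$ into $U$. -/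

import Mathlib

open Bundle Set Module
open scoped Manifold ContDiff

noncomputable section

/-- A smooth Lorentzian metric of signature `(-,+,…,+)` on the smooth `n`-manifold `M`. -/
structure LorentzianMetric (n : ℕ) (M : Type*) [TopologicalSpace M]
    [ChartedSpace (EuclideanSpace ℝ (Fin n)) M] [IsManifold (𝓡 n) ∞ M] where
  /-- The bilinear form on each tangent space. -/
  inner (p : M) : TangentSpace (𝓡 n) p →L[ℝ] TangentSpace (𝓡 n) p →L[ℝ] ℝ
  symm (p : M) (X Y : TangentSpace (𝓡 n) p) : inner p X Y = inner p Y X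
  /-- Every tangent space has an orthonormal basis with exactly one timelike vector. -/
  signature (p : M) : ∃ (b : Basis (Fin n) ℝ (TangentSpace (𝓡 n) p)) (i₀ : Fin n),
    ∀ i j, inner p (b i) (b j) = if i = j then (if i = i₀ then -1 else 1) else 0
  contMDiff : ContMDiff (𝓡 n)
    ((𝓡 n).prod 𝓘(ℝ, EuclideanSpace ℝ (Fin n) →L[ℝ] EuclideanSpace ℝ (Fin n) →L[ℝ] ℝ)) ∞
    (fun p ↦ TotalSpace.mk'
      (EuclideanSpace ℝ (Fin n) →L[ℝ] EuclideanSpace ℝ (Fin n) →L[ℝ] ℝ) p (inner p))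

section Charts

variable {n : ℕ} {M : Type*} [TopologicalSpace M] [ChartedSpace (EuclideanSpace ℝ (Fin n)) M]

/-- `φ` is a smooth coordinate chart of `M`: a member of the maximal smooth atlas. -/
def IsSmoothChart (φ : OpenPartialHomeomorph M (EuclideanSpace ℝ (Fin n))) : Prop :=
  φ ∈ IsManifold.maximalAtlas (𝓡 n) ∞ M

/-- The value `dxⁱ(X)` at `p` of the differential of the `i`-th coordinate function of `φ`; this is
also the `i`-th component of the tangent vector `X` in the chart `φ`. -/
def coordDiff (φ : OpenPartialHomeomorph M (EuclideanSpace ℝ (Fin n))) (i : Fin n) (p : M)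
    (X : TangentSpace (𝓡 n) p) : ℝ :=
  (show EuclideanSpace ℝ (Fin n) from mfderiv (𝓡 n) (𝓡 n) φ p X) i

/-- The coordinate vector field `∂/∂xⁱ` of the chart `φ` (meaningful on `φ.source`). -/
def coordField (φ : OpenPartialHomeomorph M (EuclideanSpace ℝ (Fin n))) (i : Fin n) (p : M) :
    TangentSpace (𝓡 n) p :=
  (mfderiv (𝓡 n) (𝓡 n) φ p).inverse (EuclideanSpace.single i (1 : ℝ))

/-- The partial derivative `∂f/∂xⁱ` of a function on coordinate space. -/
def partialDeriv (i : Fin n) (f : EuclideanSpace ℝ (Fin n) → ℝ) (y : EuclideanSpace ℝ (Fin n)) :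
    ℝ :=
  fderiv ℝ f y (EuclideanSpace.single i (1 : ℝ))

variable [IsManifold (𝓡 n) ∞ M]

/-- The matrix `(g_ij)` of the metric in the chart `φ`, as a function of the coordinates
`y ∈ φ.target`. -/
def LorentzianMetric.gram (g : LorentzianMetric n M)
    (φ : OpenPartialHomeomorph M (EuclideanSpace ℝ (Fin n))) (y : EuclideanSpace ℝ (Fin n)) :
    Matrix (Fin n) (Fin n) ℝ :=
  Matrix.of fun i j ↦ g.inner (φ.symm y) (coordField φ i (φ.symm y)) (coordField φ j (φ.symm y))

/-- The Christoffel symbols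
`Γᵏ_ij = ½ ∑ₗ gᵏˡ (∂_i g_jl + ∂_j g_il - ∂_l g_ij)` of the Levi-Civita connection. -/
def LorentzianMetric.christoffel (g : LorentzianMetric n M)
    (φ : OpenPartialHomeomorph M (EuclideanSpace ℝ (Fin n))) (k i j : Fin n)
    (y : EuclideanSpace ℝ (Fin n)) : ℝ :=
  (1 / 2 : ℝ) * ∑ l, (g.gram φ y)⁻¹ k l *
    (partialDeriv i (fun z ↦ g.gram φ z j l) y + partialDeriv j (fun z ↦ g.gram φ z i l) y
      - partialDeriv l (fun z ↦ g.gram φ z i j) y)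

/-- The components `Rˡ_ijk` of the curvature tensor, defined by `R(∂_i, ∂_j) ∂_k = ∑ₗ Rˡ_ijk ∂_l`
where `R(X, Y) Z = ∇_X ∇_Y Z - ∇_Y ∇_X Z - ∇_[X,Y] Z`. -/
def LorentzianMetric.curvature (g : LorentzianMetric n M)
    (φ : OpenPartialHomeomorph M (EuclideanSpace ℝ (Fin n))) (l i j k : Fin n)
    (y : EuclideanSpace ℝ (Fin n)) : ℝ :=
  partialDeriv i (g.christoffel φ l j k) y - partialDeriv j (g.christoffel φ l i k) y
    + ∑ m, (g.christoffel φ l i m y * g.christoffel φ m j k y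
      - g.christoffel φ l j m y * g.christoffel φ m i k y)

/-- The components in the chart `φ` of the covariant derivative along the curve `γ` of the vector
field along `γ` with components `W`: `(D_t W)ᵏ = dWᵏ/dt + ∑ Γᵏ_ij (dγⁱ/dt) Wʲ`. -/
def LorentzianMetric.covDerivAlong (g : LorentzianMetric n M)
    (φ : OpenPartialHomeomorph M (EuclideanSpace ℝ (Fin n))) (γ : ℝ → M)
    (W : Fin n → ℝ → ℝ) (k : Fin n) (t : ℝ) : ℝ :=
  deriv (W k) t
    + ∑ i, ∑ j, g.christoffel φ k i j (φ (γ t)) * deriv (fun s ↦ φ (γ s) i) t * W j t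

/-- `γ` is a geodesic on the open interval `D`: a smooth curve with `D_t γ̇ = 0` in every chart. -/
structure LorentzianMetric.IsGeodesicOn (g : LorentzianMetric n M) (γ : ℝ → M) (D : Set ℝ) :
    Prop where
  isOpen : IsOpen D
  ordConnected : D.OrdConnected
  contMDiffOn : ContMDiffOn 𝓘(ℝ, ℝ) (𝓡 n) ∞ γ D
  eq : ∀ φ : OpenPartialHomeomorph M (EuclideanSpace ℝ (Fin n)), IsSmoothChart φ →
    ∀ t ∈ D, γ t ∈ φ.source → ∀ k,
      g.covDerivAlong φ γ (fun i ↦ deriv fun s ↦ φ (γ s) i) k t = 0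

/-- The velocity vector `γ̇(t)`. -/
def velocity (γ : ℝ → M) (t : ℝ) : TangentSpace (𝓡 n) (γ t) :=
  mfderiv 𝓘(ℝ, ℝ) (𝓡 n) γ t (1 : ℝ)

/-- `γ` is a null geodesic on the open interval `D`: a geodesic whose velocity is a (nonzero) null
vector everywhere. -/
structure LorentzianMetric.IsNullGeodesicOn (g : LorentzianMetric n M) (γ : ℝ → M) (D : Set ℝ) :
    Prop extends g.IsGeodesicOn γ D where
  velocity_ne_zero : ∀ t ∈ D, velocity (n := n) γ t ≠ 0
  null : ∀ t ∈ D, g.inner (γ t) (velocity γ t) (velocity γ t) = 0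

/-- `V` is a Jacobi field along `γ` on `D`: a smooth vector field along `γ` satisfying
`D_t D_t V + R(V, γ̇) γ̇ = 0` in every chart. -/
structure LorentzianMetric.IsJacobiFieldOn (g : LorentzianMetric n M) (γ : ℝ → M) (D : Set ℝ)
    (V : ∀ t, TangentSpace (𝓡 n) (γ t)) : Prop where
  contDiffOn : ∀ φ : OpenPartialHomeomorph M (EuclideanSpace ℝ (Fin n)), IsSmoothChart φ →
    ∀ i, ContDiffOn ℝ ∞ (fun t ↦ coordDiff φ i (γ t) (V t)) (D ∩ γ ⁻¹' φ.source)
  eq : ∀ φ : OpenPartialHomeomorph M (EuclideanSpace ℝ (Fin n)), IsSmoothChart φ →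
    ∀ t ∈ D, γ t ∈ φ.source → ∀ l,
      g.covDerivAlong φ γ
          (g.covDerivAlong φ γ fun i s ↦ coordDiff φ i (γ s) (V s)) l t
        + ∑ i, ∑ j, ∑ k, g.curvature φ l i j k (φ (γ t)) * coordDiff φ i (γ t) (V t)
            * deriv (fun s ↦ φ (γ s) j) t * deriv (fun s ↦ φ (γ s) k) t = 0

/-- The parameters `s ≠ t` in `D` are conjugate along the geodesic `γ : D → M`: some Jacobi field
along `γ` that does not vanish identically vanishes at both. -/
def LorentzianMetric.AreConjugateAlong (g : LorentzianMetric n M) (γ : ℝ → M) (D : Set ℝ)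
    (s t : ℝ) : Prop :=
  s ≠ t ∧ ∃ V : ∀ r, TangentSpace (𝓡 n) (γ r),
    g.IsJacobiFieldOn γ D V ∧ V s = 0 ∧ V t = 0 ∧ ∃ r ∈ D, V r ≠ 0

/-- The portion of the geodesic `γ : D → M` with parameter interval `J ⊆ D` is free of conjugate
points. -/
structure LorentzianMetric.IsConjugatePointFreePortion (g : LorentzianMetric n M) (γ : ℝ → M)
    (D J : Set ℝ) : Prop where
  subset : J ⊆ D
  ordConnected : J.OrdConnected
  not_conjugate : ∀ s ∈ J, ∀ t ∈ J, ¬ g.AreConjugateAlong γ D s t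

end Charts

section NullCoordinates

variable {m : ℕ} {M : Type*} [TopologicalSpace M]
  [ChartedSpace (EuclideanSpace ℝ (Fin (m + 2))) M] [IsManifold (𝓡 (m + 2)) ∞ M]

/-- The index of the coordinate `xᵃ` when the coordinates are ordered as `(u, v, x¹, …, xᵐ)`. -/
def xIdx (a : Fin m) : Fin (m + 2) := a.succ.succ

/-- `ψ` is a chart of null coordinates `(u, v, x¹, …, xᵐ)`, `m = n - 2`: on its domain
`g = 2 du dv + H du² + 2 A_a dxᵃ du + h_ab dxᵃ dxᵇ` for smooth functions `H`, `A_a`, `h_ab` of the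
coordinates, with `(h_ab)` positive definite.  Products of one-forms are symmetrized, so that
`2 du dv = du ⊗ dv + dv ⊗ du`. -/
def LorentzianMetric.IsNullCoordinateChart (g : LorentzianMetric (m + 2) M)
    (ψ : OpenPartialHomeomorph M (EuclideanSpace ℝ (Fin (m + 2)))) : Prop :=
  IsSmoothChart ψ ∧
  ∃ (H : EuclideanSpace ℝ (Fin (m + 2)) → ℝ) (A : Fin m → EuclideanSpace ℝ (Fin (m + 2)) → ℝ)
    (h : EuclideanSpace ℝ (Fin (m + 2)) → Matrix (Fin m) (Fin m) ℝ),
    ContDiffOn ℝ ∞ H ψ.target ∧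
    (∀ a, ContDiffOn ℝ ∞ (A a) ψ.target) ∧
    (∀ a b, ContDiffOn ℝ ∞ (fun y ↦ h y a b) ψ.target) ∧
    (∀ y ∈ ψ.target, (h y).PosDef) ∧
    ∀ p ∈ ψ.source, ∀ X Y : TangentSpace (𝓡 (m + 2)) p,
      g.inner p X Y =
        (coordDiff ψ 0 p X * coordDiff ψ 1 p Y + coordDiff ψ 1 p X * coordDiff ψ 0 p Y)
        + H (ψ p) * coordDiff ψ 0 p X * coordDiff ψ 0 p Y
        + ∑ a, A a (ψ p) * (coordDiff ψ (xIdx a) p X * coordDiff ψ 0 p Y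
            + coordDiff ψ 0 p X * coordDiff ψ (xIdx a) p Y)
        + ∑ a, ∑ b, h (ψ p) a b * coordDiff ψ (xIdx a) p X * coordDiff ψ (xIdx b) p Y

end NullCoordinates

end

/-! The coordinates come from a Hamiltonian flow. Let `P` be the inverse metric in some chart, and
consider the energy ½ p(P p) on covectors. If γ is a geodesic, then its position together with its
velocity lowered by the metric solves Hamilton's equations
(`LorentzianMetric.IsGeodesicOn.hasDerivAt_momentum`, `hamiltonianField_inverse_eq`).

Take a flat hypersurface through γ(t₀) transversal to the velocity there. Along it choose null
covectors ϖ that restrict to du on the hypersurface and equal the lowered velocity at γ(t₀). Flowing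
for time v yields a map Ψ(u, v, x) with momentum ϖ(u, v, x) and ∂_vΨ = Pϖ. The energy is conserved,
so ϖ stays null and ϖ(∂_vΨ) = 0. For a fixed direction w, the v-derivative of ϖ(∂_wΨ) is the
w-derivative of the energy, which is now zero (`fderiv_momentum_eq_zero`). So the initial values
persist and the pullback of ϖ by Ψ is du everywhere. Lowering ∂_vΨ gives back ϖ, hence g(∂_v, ·) =
du, that is g_vv = g_va = 0 and g_uv = 1. The remaining components are unrestricted, except that
(g_ab) must be positive definite. A frame at γ(t₀) adapted to the null velocity makes it the
identity at the origin, so it is positive definite nearby.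

Two analytic ingredients remain. Smooth dependence of a flow on time and initial value
(`exists_contDiffOn_flow`) follows from the inverse function theorem applied to the integral
equation on the Banach space of continuous curves. The inverse function theorem, applied to Ψ, also
produces the chart. By uniqueness for ordinary differential equations γ is the v-axis near t₀. The
chart is cut down to have a ball as image, so that a curve following the v-axis can only stop doing
so by leaving the chart (`eq_smul_single_of_image_uIcc_subset`). -/

set_option maxSynthPendingDepth 3

noncomputable section

/-! ### Smoothness of superposition operators on spaces of continuous functions; inverse function
theorem. -/

section Superposition

open ContinuousMap Filter Topology

universe u

variable {K : Type*} [TopologicalSpace K] [CompactSpace K]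

/-- Pointwise application, as a continuous bilinear map on spaces of continuous functions. -/
def ContinuousMap.pointwiseApplyL (K : Type*) [TopologicalSpace K] [CompactSpace K]
    (E F : Type*) [NormedAddCommGroup E] [NormedSpace ℝ E]
    [NormedAddCommGroup F] [NormedSpace ℝ F] :
    C(K, E →L[ℝ] F) →L[ℝ] C(K, E) →L[ℝ] C(K, F) :=
  LinearMap.mkContinuous₂
    (LinearMap.mk₂ ℝ (fun (A : C(K, E →L[ℝ] F)) (h : C(K, E)) ↦
        (⟨fun k ↦ A k (h k), by fun_prop⟩ : C(K, F)))
      (fun _ _ _ ↦ by ext; simp) (fun _ _ _ ↦ by ext; simp)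
      (fun _ _ _ ↦ by ext; simp) (fun _ _ _ ↦ by ext; simp)) 1 (by
    intro A h
    rw [ContinuousMap.norm_le _ (by positivity)]
    intro k
    simp only [LinearMap.mk₂_apply, ContinuousMap.coe_mk, one_mul]
    exact (A k).le_of_opNorm_le_of_le (A.norm_coe_le_norm k) (h.norm_coe_le_norm k))

@[simp] lemma ContinuousMap.pointwiseApplyL_apply {E F : Type*} [NormedAddCommGroup E]
    [NormedSpace ℝ E] [NormedAddCommGroup F] [NormedSpace ℝ F]
    (A : C(K, E →L[ℝ] F)) (h : C(K, E)) (k : K) :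
    ContinuousMap.pointwiseApplyL K E F A h k = A k (h k) := rfl

/-- The superposition operator `α ↦ f ∘ α` of a `C¹` map is differentiable. -/
lemma hasFDerivAt_comp_continuousMap {E F : Type*} [NormedAddCommGroup E] [NormedSpace ℝ E]
    [NormedAddCommGroup F] [NormedSpace ℝ F] {f : E → F} {f' : E → E →L[ℝ] F}
    (hf : ∀ x, HasFDerivAt f (f' x) x) (hf' : Continuous f') (hfc : Continuous f) (α : C(K, E)) :
    HasFDerivAt (fun β : C(K, E) ↦ ContinuousMap.comp ⟨f, hfc⟩ β)
      (ContinuousMap.pointwiseApplyL K E F (ContinuousMap.comp ⟨f', hf'⟩ α)) α := by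
  rw [hasFDerivAt_iff_isLittleO_nhds_zero, Asymptotics.isLittleO_iff]
  intro c hc
  have hcont : Continuous fun β : C(K, E) ↦ ContinuousMap.comp ⟨f', hf'⟩ β :=
    ContinuousMap.continuous_postcomp _
  obtain ⟨δ, hδ, hball⟩ : ∃ δ > 0, ∀ β : C(K, E), dist β α < δ →
      dist (ContinuousMap.comp ⟨f', hf'⟩ β) (ContinuousMap.comp ⟨f', hf'⟩ α) < c :=
    Metric.continuous_iff.1 hcont α c hc
  filter_upwards [Metric.ball_mem_nhds (0 : C(K, E)) hδ] with h hh
  rw [mem_ball_zero_iff] at hh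
  rw [ContinuousMap.norm_le _ (by positivity)]
  intro k
  -- Points of the segment are values of the function α + s • h, which is uniformly δ-close to α.
  -- Continuity of β ↦ f' ∘ β in the sup norm therefore bounds f' on all segments at once.
  have key : ∀ y ∈ segment ℝ (α k) (α k + h k), ‖f' y - f' (α k)‖ ≤ c := by
    intro y hy
    rw [segment_eq_image'] at hy
    obtain ⟨s, hs, rfl⟩ := hy
    have h1 : dist (α + s • h) α < δ := by
      rw [dist_eq_norm, add_sub_cancel_left, norm_smul, Real.norm_of_nonneg hs.1]
      exact lt_of_le_of_lt (mul_le_of_le_one_left (norm_nonneg _) hs.2) hh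
    have h2 := (ContinuousMap.dist_apply_le_dist (f := ContinuousMap.comp ⟨f', hf'⟩ (α + s • h))
      (g := ContinuousMap.comp ⟨f', hf'⟩ α) k).trans (hball _ h1).le
    simpa [dist_eq_norm] using h2
  have := (convex_segment (α k) (α k + h k)).norm_image_sub_le_of_norm_hasFDerivWithin_le'
    (f := f) (f' := f') (φ := f' (α k)) (C := c)
    (fun y _ ↦ (hf y).hasFDerivWithinAt) key (left_mem_segment ℝ _ _) (right_mem_segment ℝ _ _)
  calc _ = ‖f (α k + h k) - f (α k) - f' (α k) (α k + h k - α k)‖ := by simp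
    _ ≤ c * ‖α k + h k - α k‖ := this
    _ ≤ c * ‖h‖ := by
      rw [add_sub_cancel_left]
      exact mul_le_mul_of_nonneg_left (h.norm_coe_le_norm k) hc.le

/-- The superposition operator `α ↦ f ∘ α` of a `Cⁿ` map is `Cⁿ`. -/
lemma contDiff_nat_comp_continuousMap {E : Type u} [NormedAddCommGroup E] [NormedSpace ℝ E]
    (n : ℕ) : ∀ {F : Type u} [NormedAddCommGroup F] [NormedSpace ℝ F] {f : E → F}
    (hf : ContDiff ℝ n f),
    ContDiff ℝ n (fun β : C(K, E) ↦ ContinuousMap.comp ⟨f, hf.continuous⟩ β) := by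
  induction n with
  | zero =>
    intro F _ _ f hf
    exact contDiff_zero.2 (ContinuousMap.continuous_postcomp _)
  | succ n ih =>
    intro F _ _ f hf
    have hf1 : ContDiff ℝ (n + 1) f := by exact_mod_cast hf
    have hd : ContDiff ℝ n (fderiv ℝ f) := hf1.fderiv_right le_rfl
    have hdiff : Differentiable ℝ f := hf1.differentiable (by simp)
    have : ContDiff ℝ ((n : WithTop ℕ∞) + 1)
        (fun β : C(K, E) ↦ ContinuousMap.comp ⟨f, hf.continuous⟩ β) := by
      rw [contDiff_succ_iff_hasFDerivAt]
      refine ⟨_, ?_, fun α ↦ hasFDerivAt_comp_continuousMap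
        (fun x ↦ (hdiff x).hasFDerivAt) hd.continuous hf.continuous α⟩
      -- The induction hypothesis is used for `fderiv ℝ f`, with values in `E →L[ℝ] F`. Hence the
      -- target varies in the induction and shares a universe with E.
      exact (ContinuousMap.pointwiseApplyL K E F).contDiff.comp (ih hd)
    exact_mod_cast this

lemma contDiff_comp_continuousMap {E F : Type u} [NormedAddCommGroup E] [NormedSpace ℝ E]
    [NormedAddCommGroup F] [NormedSpace ℝ F] {f : E → F} (hf : ContDiff ℝ ∞ f) :
    ContDiff ℝ ∞ (fun β : C(K, E) ↦ ContinuousMap.comp ⟨f, hf.continuous⟩ β) :=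
  contDiff_infty.2 fun n ↦ contDiff_nat_comp_continuousMap n (hf.of_le (by exact_mod_cast le_top))

end Superposition

/-- The inverse function theorem, with a local inverse that is smooth on its whole domain. -/
lemma ContDiffOn.exists_openPartialHomeomorph {E F : Type*} [NormedAddCommGroup E]
    [NormedSpace ℝ E] [CompleteSpace E] [NormedAddCommGroup F] [NormedSpace ℝ F] {f : E → F}
    {s : Set E} (hs : IsOpen s) (hf : ContDiffOn ℝ ∞ f s) {a : E} (ha : a ∈ s) (f' : E ≃L[ℝ] F)
    (hf' : HasFDerivAt f (f' : E →L[ℝ] F) a) :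
    ∃ e : OpenPartialHomeomorph E F, a ∈ e.source ∧ e.source ⊆ s ∧ (∀ x, e x = f x) ∧
      ContDiffOn ℝ ∞ e.symm e.target := by
  have hfa : ContDiffAt ℝ ∞ f a := hf.contDiffAt (hs.mem_nhds ha)
  let e₀ := hfa.toOpenPartialHomeomorph f hf' (by simp)
  -- The local inverse is smooth wherever the derivative is invertible, and this is an open
  -- condition.
  let t : Set E := s ∩ fderiv ℝ f ⁻¹' range ((↑) : (E ≃L[ℝ] F) → E →L[ℝ] F)
  have ht : IsOpen t :=
    ((hf.fderiv_of_isOpen hs (m := ∞) (by simp)).continuousOn).isOpen_inter_preimage hs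
      ContinuousLinearEquiv.isOpen
  have hat : a ∈ t := ⟨ha, f', hf'.fderiv.symm⟩
  refine ⟨e₀.restrOpen t ht, ⟨hfa.mem_toOpenPartialHomeomorph_source hf' (by simp), hat⟩,
    fun x hx ↦ hx.2.1, fun x ↦ rfl, fun y hy ↦ ContDiffAt.contDiffWithinAt ?_⟩
  have hy' := (e₀.restrOpen t ht).map_target hy
  obtain ⟨g, hg⟩ := hy'.2.2
  refine (e₀.restrOpen t ht).contDiffAt_symm (f₀' := g) hy ?_
    (hf.contDiffAt (hs.mem_nhds hy'.2.1))
  rw [hg]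
  exact ((hf.contDiffAt (hs.mem_nhds hy'.2.1)).differentiableAt (by simp)).hasFDerivAt

/-! ### Smooth dependence of flows on time and initial value. -/

section Flow

open Filter Topology

/-- The primitive vanishing at `0` of a continuous function on `[-1, 1]`. -/
def primitiveL (E : Type*) [NormedAddCommGroup E] [NormedSpace ℝ E] :
    C(Icc (-1 : ℝ) 1, E) →L[ℝ] C(Icc (-1 : ℝ) 1, E) :=
  LinearMap.mkContinuous
    { toFun := fun h ↦ ⟨fun s ↦ ∫ τ in (0 : ℝ)..s, h (projIcc (-1) 1 (by norm_num) τ), by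
        have : Continuous fun τ ↦ h (projIcc (-1 : ℝ) 1 (by norm_num) τ) :=
          h.continuous.comp continuous_projIcc
        exact (intervalIntegral.continuous_primitive
          (fun a b ↦ this.intervalIntegrable a b) 0).comp continuous_subtype_val⟩
      map_add' := fun h k ↦ by
        ext s
        exact intervalIntegral.integral_add
          ((h.continuous.comp continuous_projIcc).intervalIntegrable _ _)
          ((k.continuous.comp continuous_projIcc).intervalIntegrable _ _)
      map_smul' := fun c h ↦ by
        ext s
        exact intervalIntegral.integral_smul _ _ } 1 (by
    intro h
    rw [ContinuousMap.norm_le _ (by positivity)]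
    intro s
    have := intervalIntegral.norm_integral_le_of_norm_le_const (a := 0) (b := (s : ℝ))
      (f := fun τ ↦ h (projIcc (-1 : ℝ) 1 (by norm_num) τ)) (C := ‖h‖)
      (fun τ _ ↦ h.norm_coe_le_norm _)
    refine this.trans ?_
    rw [one_mul, sub_zero]
    exact mul_le_of_le_one_right (norm_nonneg _) (abs_le.2 s.2))

lemma primitiveL_apply {E : Type*} [NormedAddCommGroup E] [NormedSpace ℝ E]
    (h : C(Icc (-1 : ℝ) 1, E)) (s : Icc (-1 : ℝ) 1) :
    primitiveL E h s = ∫ τ in (0 : ℝ)..s, h (projIcc (-1) 1 (by norm_num) τ) := rfl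

universe u

variable {E : Type u} [NormedAddCommGroup E] [NormedSpace ℝ E]

/-- The integral equation of the time-rescaled flow of `f`, with time and initial value as
parameters. -/
def flowEquation (f : E → E) (hf : Continuous f)
    (z : (ℝ × E) × C(Icc (-1 : ℝ) 1, E)) : (ℝ × E) × C(Icc (-1 : ℝ) 1, E) :=
  (z.1, z.2 - ContinuousMap.const _ z.1.2 - z.1.1 • primitiveL E (ContinuousMap.comp ⟨f, hf⟩ z.2))

lemma contDiff_flowEquation {f : E → E} (hf : ContDiff ℝ ∞ f) :
    ContDiff ℝ ∞ (flowEquation f hf.continuous) := by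
  have hc : ContDiff ℝ ∞ fun x : E ↦ ContinuousMap.const (Icc (-1 : ℝ) 1) x :=
    (ContinuousLinearMap.const ℝ (Icc (-1 : ℝ) 1) : E →L[ℝ] _).contDiff
  refine contDiff_fst.prodMk ((contDiff_snd.sub (hc.comp (contDiff_snd.comp contDiff_fst))).sub
    ((contDiff_fst.comp contDiff_fst).smul
      ((primitiveL E).contDiff.comp ((contDiff_comp_continuousMap hf).comp contDiff_snd))))

/-- At time T = 0 the derivative of the nonlinear term in the curve variable is multiplied by T and
disappears. What remains is (T, x, h) ↦ (T, x, h - x - T • w), which is triangular with identity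
diagonal blocks, so invertible. -/
lemma hasFDerivAt_flowEquation {f : E → E} (hf : ContDiff ℝ ∞ f) (x₀ : E) :
    ∃ e : ((ℝ × E) × C(Icc (-1 : ℝ) 1, E)) ≃L[ℝ] ((ℝ × E) × C(Icc (-1 : ℝ) 1, E)),
      HasFDerivAt (flowEquation f hf.continuous)
        (e : ((ℝ × E) × C(Icc (-1 : ℝ) 1, E)) →L[ℝ] _)
        ((0, x₀), ContinuousMap.const _ x₀) := by
  let c : E →L[ℝ] C(Icc (-1 : ℝ) 1, E) := ContinuousLinearMap.const ℝ _
  let w : C(Icc (-1 : ℝ) 1, E) := primitiveL E (ContinuousMap.const _ (f x₀))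
  let A : ℝ × E →L[ℝ] C(Icc (-1 : ℝ) 1, E) :=
    -(c ∘L ContinuousLinearMap.snd ℝ ℝ E) - (ContinuousLinearMap.fst ℝ ℝ E).smulRight w
  refine ⟨(ContinuousLinearEquiv.refl ℝ (ℝ × E)).skewProd (ContinuousLinearEquiv.refl ℝ _) A, ?_⟩
  have hN : HasFDerivAt (fun β : C(Icc (-1 : ℝ) 1, E) ↦
      primitiveL E (ContinuousMap.comp ⟨f, hf.continuous⟩ β))
      (fderiv ℝ (fun β : C(Icc (-1 : ℝ) 1, E) ↦
        primitiveL E (ContinuousMap.comp ⟨f, hf.continuous⟩ β)) (ContinuousMap.const _ x₀))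
      (ContinuousMap.const _ x₀) :=
    ((((primitiveL E).contDiff.comp (contDiff_comp_continuousMap hf)).differentiable
      (by simp)) _).hasFDerivAt
  have h1 : HasFDerivAt (fun z : (ℝ × E) × C(Icc (-1 : ℝ) 1, E) ↦ z.1.1)
      (ContinuousLinearMap.fst ℝ ℝ E ∘L ContinuousLinearMap.fst ℝ (ℝ × E) _)
      ((0, x₀), ContinuousMap.const _ x₀) :=
    hasFDerivAt_fst.fst
  have h2 := h1.smul (hN.comp ((0, x₀), ContinuousMap.const _ x₀)
    (ContinuousLinearMap.snd ℝ (ℝ × E) _).hasFDerivAt)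
  have h3 : HasFDerivAt (fun z : (ℝ × E) × C(Icc (-1 : ℝ) 1, E) ↦
      z.2 - ContinuousMap.const (Icc (-1 : ℝ) 1) z.1.2)
      (ContinuousLinearMap.snd ℝ (ℝ × E) _ -
        c ∘L ContinuousLinearMap.snd ℝ ℝ E ∘L ContinuousLinearMap.fst ℝ (ℝ × E) _)
      ((0, x₀), ContinuousMap.const _ x₀) :=
    (ContinuousLinearMap.snd ℝ (ℝ × E) _ -
        c ∘L ContinuousLinearMap.snd ℝ ℝ E ∘L ContinuousLinearMap.fst ℝ (ℝ × E) _).hasFDerivAt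
  have h4 := (ContinuousLinearMap.fst ℝ (ℝ × E) C(Icc (-1 : ℝ) 1, E)).hasFDerivAt.prodMk
    (h3.sub h2)
  refine h4.congr_fderiv ?_
  ext1
  · ext <;> simp [A, c, w]
  · ext <;> simp [A, c, w]

/-- The time-rescaling of a solution of the flow equation. -/
lemma flowEquation_comp_mul {f : E → E} (hf : Continuous f) {T : ℝ} {x : E}
    {α : C(Icc (-1 : ℝ) 1, E)} (h : flowEquation f hf ((T, x), α) = ((T, x), 0))
    (s : Icc (-1 : ℝ) 1) {β : C(Icc (-1 : ℝ) 1, E)}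
    (hβ : ∀ r : Icc (-1 : ℝ) 1, β r = α (projIcc (-1) 1 (by norm_num) (s * r))) :
    flowEquation f hf ((s * T, x), β) = ((s * T, x), 0) := by
  have hα : ∀ r : Icc (-1 : ℝ) 1, α r = x + T • ∫ τ in (0 : ℝ)..r,
      f (α (projIcc (-1) 1 (by norm_num) τ)) := by
    intro r
    have := DFunLike.congr_fun (congrArg Prod.snd h) r
    simp only [flowEquation, ContinuousMap.sub_apply, ContinuousMap.const_apply,
      ContinuousMap.smul_apply, primitiveL_apply, ContinuousMap.comp_apply,
      ContinuousMap.coe_mk, ContinuousMap.zero_apply] at this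
    rw [sub_eq_zero, sub_eq_iff_eq_add] at this
    rw [this, add_comm]
  refine Prod.ext rfl ?_
  ext r
  have hmem : ∀ ρ ∈ Icc (-1 : ℝ) 1, (s : ℝ) * ρ ∈ Icc (-1 : ℝ) 1 := by
    intro ρ hρ
    refine abs_le.1 ?_
    rw [abs_mul]
    exact mul_le_one₀ (abs_le.2 s.2) (abs_nonneg _) (abs_le.2 hρ)
  simp only [flowEquation, ContinuousMap.sub_apply, ContinuousMap.const_apply,
      ContinuousMap.smul_apply, primitiveL_apply, ContinuousMap.comp_apply,
      ContinuousMap.coe_mk, ContinuousMap.zero_apply]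
  rw [hβ r, hα, projIcc_of_mem _ (hmem r r.2)]
  -- Substitution τ ↦ s τ; with the factor s kept on the left, s = 0 needs no separate treatment.
  have hint : (s : ℝ) • ∫ τ in (0 : ℝ)..r, f (β (projIcc (-1) 1 (by norm_num) τ)) =
      ∫ τ in (0 : ℝ)..(s * r : ℝ), f (α (projIcc (-1) 1 (by norm_num) τ)) := by
    have := intervalIntegral.smul_integral_comp_mul_left (a := 0) (b := (r : ℝ))
      (fun τ ↦ f (α (projIcc (-1) 1 (by norm_num) τ))) (s : ℝ)
    rw [mul_zero] at this
    rw [← this]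
    congr 1
    refine intervalIntegral.integral_congr fun τ hτ ↦ ?_
    have hτ' : τ ∈ Icc (-1 : ℝ) 1 :=
      (ordConnected_Icc.uIcc_subset (by norm_num) r.2) hτ
    rw [hβ, projIcc_of_mem _ hτ']
  rw [← hint, smul_smul, mul_comm T]
  abel

/-- Smooth dependence of the local flow of a smooth vector field on time and initial value. -/
theorem exists_contDiffOn_flow [CompleteSpace E] {f : E → E} (hf : ContDiff ℝ ∞ f) (x₀ : E) :
    ∃ (φ : ℝ × E → E) (U : Set (ℝ × E)), IsOpen U ∧ (0, x₀) ∈ U ∧ ContDiffOn ℝ ∞ φ U ∧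
      (∀ x, (0, x) ∈ U → φ (0, x) = x) ∧
      ∀ t x, (t, x) ∈ U → HasDerivAt (fun s ↦ φ (s, x)) (f (φ (t, x))) t := by
  obtain ⟨e', he'⟩ := hasFDerivAt_flowEquation hf x₀
  obtain ⟨e, hae, -, hef, hsymm⟩ :=
    (contDiff_flowEquation hf).contDiffOn.exists_openPartialHomeomorph
    isOpen_univ (mem_univ _) e' he'
  set c₀ : C(Icc (-1 : ℝ) 1, E) := ContinuousMap.const _ x₀ with hc₀
  obtain ⟨r, hr, hrs⟩ := Metric.isOpen_iff.1 e.open_source _ hae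
  have hI : e ((0, x₀), c₀) = ((0, x₀), 0) := by
    rw [hef]
    refine Prod.ext rfl ?_
    ext s
    simp [flowEquation, hc₀]
  let ι : ℝ × E → (ℝ × E) × C(Icc (-1 : ℝ) 1, E) := fun z ↦ (z, 0)
  have hι : ContDiff ℝ ∞ ι := contDiff_id.prodMk contDiff_const
  have h0 : ι (0, x₀) ∈ e.target := by
    show ((0, x₀), (0 : C(Icc (-1 : ℝ) 1, E))) ∈ e.target
    rw [← hI]
    exact e.map_source hae
  -- The solutions are also kept in a ball inside `e.source`, so that injectivity of `e` can serve
  -- as a uniqueness theorem for rescaled solutions.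
  have hopen : IsOpen (ι ⁻¹' (e.target ∩ e.symm ⁻¹' Metric.ball ((0, x₀), c₀) r)) :=
    (e.isOpen_inter_preimage_symm Metric.isOpen_ball).preimage hι.continuous
  have hmem0 : (0, x₀) ∈ ι ⁻¹' (e.target ∩ e.symm ⁻¹' Metric.ball ((0, x₀), c₀) r) := by
    refine ⟨h0, ?_⟩
    show e.symm ((0, x₀), (0 : C(Icc (-1 : ℝ) 1, E))) ∈ Metric.ball ((0, x₀), c₀) r
    rw [← hI, e.left_inv hae]
    exact Metric.mem_ball_self hr
  obtain ⟨δ, hδ, hδs⟩ := Metric.isOpen_iff.1 hopen _ hmem0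
  let α : ℝ × E → C(Icc (-1 : ℝ) 1, E) := fun z ↦ (e.symm (ι z)).2
  have hfst : ∀ z ∈ Metric.ball ((0 : ℝ), x₀) δ, e.symm (ι z) = (z, α z) := by
    intro z hz
    have h1 := e.right_inv (hδs hz).1
    rw [hef] at h1
    have h2 : (e.symm (ι z)).1 = z := congrArg Prod.fst h1
    exact Prod.ext h2 rfl
  have hsol : ∀ z ∈ Metric.ball ((0 : ℝ), x₀) δ,
      flowEquation f hf.continuous (z, α z) = (z, 0) := by
    intro z hz
    rw [← hfst z hz, ← hef]
    exact e.right_inv (hδs hz).1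
  have hα : ContDiffOn ℝ ∞ α (Metric.ball ((0 : ℝ), x₀) δ) :=
    contDiff_snd.comp_contDiffOn (hsymm.comp hι.contDiffOn fun z hz ↦ (hδs hz).1)
  let one : Icc (-1 : ℝ) 1 := ⟨1, by norm_num⟩
  let φ : ℝ × E → E := fun z ↦ α z one
  -- α (T, x) is the solution on [-T, T] rescaled to [-1, 1], and φ is its value at 1. The identity
  -- says that solutions for different T are rescalings of one curve, which is what recovers the
  -- differential equation below.
  have hval : ∀ T x, (T, x) ∈ Metric.ball ((0 : ℝ), x₀) δ → ∀ s : Icc (-1 : ℝ) 1,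
      φ (s * T, x) = α (T, x) s := by
    intro T x hT s
    have hsT : ((s : ℝ) * T, x) ∈ Metric.ball ((0 : ℝ), x₀) δ := by
      rw [← ball_prod_same, mem_prod, Metric.mem_ball, Metric.mem_ball, dist_zero_right] at hT ⊢
      refine ⟨lt_of_le_of_lt ?_ hT.1, hT.2⟩
      rw [norm_mul]
      exact mul_le_of_le_one_left (norm_nonneg _) (abs_le.2 s.2)
    let β : C(Icc (-1 : ℝ) 1, E) :=
      ⟨fun r ↦ α (T, x) (projIcc (-1) 1 (by norm_num) (s * r)),
        (α (T, x)).continuous.comp ((continuous_projIcc (h := by norm_num)).comp (by fun_prop))⟩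
    have hβ : flowEquation f hf.continuous ((s * T, x), β) = ((s * T, x), 0) :=
      flowEquation_comp_mul hf.continuous (hsol _ hT) s fun r ↦ rfl
    -- β takes only values of α (T, x), so it is no farther from the constant curve c₀.
    have hβs : ((s * T, x), β) ∈ e.source := by
      refine hrs ?_
      have h1 := (hδs hT).2
      rw [mem_preimage, hfst _ hT, ← ball_prod_same] at h1
      have h2 := (hδs hsT).2
      rw [mem_preimage, hfst _ hsT, ← ball_prod_same] at h2
      rw [← ball_prod_same]
      refine ⟨h2.1, ?_⟩
      have h3 := h1.2
      simp only [Metric.mem_ball] at h3 ⊢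
      refine lt_of_le_of_lt ?_ h3
      rw [ContinuousMap.dist_le dist_nonneg]
      intro r
      exact ContinuousMap.dist_apply_le_dist (f := α (T, x)) (g := c₀) _
    have h4 : e.symm (ι (s * T, x)) = ((s * T, x), β) := by
      rw [← e.left_inv hβs, hef, hβ]
    have h5 : α (s * T, x) = β := congrArg Prod.snd h4
    show α (s * T, x) one = _
    rw [h5]
    show α (T, x) (projIcc (-1) 1 (by norm_num) (s * 1)) = _
    rw [mul_one, projIcc_val]
  refine ⟨φ, Metric.ball (0, x₀) δ, Metric.isOpen_ball, Metric.mem_ball_self hδ, ?_, ?_, ?_⟩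
  · have : ContDiff ℝ ∞ fun h : C(Icc (-1 : ℝ) 1, E) ↦ h one :=
      (ContinuousMap.evalCLM ℝ one : C(Icc (-1 : ℝ) 1, E) →L[ℝ] E).contDiff
    exact this.comp_contDiffOn hα
  · intro x hx
    have := DFunLike.congr_fun (congrArg Prod.snd (hsol _ hx)) one
    simp only [flowEquation, ContinuousMap.sub_apply, ContinuousMap.const_apply, zero_smul,
      sub_zero, ContinuousMap.zero_apply] at this
    exact sub_eq_zero.1 this
  · intro t x htx
    have htx' := htx
    rw [← ball_prod_same, mem_prod, Metric.mem_ball, dist_zero_right, Real.norm_eq_abs] at htx'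
    -- A fixed T beyond |t| expresses φ (s, x), for s near t, through a single curve α (T, x)
    -- evaluated at s / T. The fundamental theorem of calculus then applies.
    obtain ⟨T, hT1, hT2⟩ := exists_between htx'.1
    have hTpos : 0 < T := (abs_nonneg t).trans_lt hT1
    have hTx : (T, x) ∈ Metric.ball ((0 : ℝ), x₀) δ := by
      rw [← ball_prod_same, mem_prod, Metric.mem_ball, dist_zero_right, Real.norm_eq_abs,
        abs_of_pos hTpos]
      exact ⟨hT2, htx'.2⟩
    let g : ℝ → E := fun τ ↦ f (α (T, x) (projIcc (-1) 1 (by norm_num) τ))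
    have hg : Continuous g :=
      hf.continuous.comp ((α (T, x)).continuous.comp continuous_projIcc)
    have hdiv : ∀ s ∈ Ioo (-T) T, s / T ∈ Icc (-1 : ℝ) 1 := fun s hs ↦ by
      constructor
      · rw [le_div_iff₀ hTpos]; linarith [hs.1]
      · rw [div_le_iff₀ hTpos]; linarith [hs.2]
    have hφ : ∀ s (hs : s ∈ Ioo (-T) T), φ (s, x) = α (T, x) ⟨s / T, hdiv s hs⟩ := by
      intro s hs
      rw [← hval T x hTx ⟨s / T, hdiv s hs⟩]
      simp [div_mul_cancel₀ _ hTpos.ne']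
    have hφ' : ∀ s ∈ Ioo (-T) T, φ (s, x) = x + T • ∫ τ in (0 : ℝ)..(s / T), g τ := by
      intro s hs
      rw [hφ s hs]
      have := DFunLike.congr_fun (congrArg Prod.snd (hsol _ hTx)) ⟨s / T, hdiv s hs⟩
      simp only [flowEquation, ContinuousMap.sub_apply, ContinuousMap.const_apply,
        ContinuousMap.smul_apply, primitiveL_apply, ContinuousMap.comp_apply,
        ContinuousMap.coe_mk, ContinuousMap.zero_apply] at this
      rw [sub_eq_zero, sub_eq_iff_eq_add] at this
      rw [this, add_comm]
    have ht : t ∈ Ioo (-T) T := abs_lt.1 hT1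
    have hder : HasDerivAt (fun s : ℝ ↦ x + T • ∫ τ in (0 : ℝ)..(s / T), g τ)
        (f (φ (t, x))) t := by
      have h1 := (intervalIntegral.integral_hasDerivAt_right (hg.intervalIntegrable 0 (t / T))
        hg.stronglyMeasurable.stronglyMeasurableAtFilter hg.continuousAt)
      have h2 := ((h1.scomp t ((hasDerivAt_id t).div_const T)).const_smul T).const_add x
      refine h2.congr_deriv ?_
      rw [smul_smul, mul_one_div_cancel hTpos.ne', one_smul, hφ t ht]
      show f _ = _
      rw [projIcc_of_mem _ (hdiv t ht)]
    refine hder.congr_of_eventuallyEq ?_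
    filter_upwards [Ioo_mem_nhds ht.1 ht.2] with s hs using hφ' s hs

end Flow

/-! ### Hamilton's equations, their conservation laws, and null covector fields. -/

section Hamiltonian

open Filter Topology

variable {E F : Type*} [NormedAddCommGroup E] [NormedSpace ℝ E] [NormedAddCommGroup F]
  [NormedSpace ℝ F]

/-- The Hamiltonian vector field of `(x, p) ↦ ½ p (P x p)`, for a field `P` of symmetric bilinear
forms on covectors. -/
def hamiltonianField (P : E → (E →L[ℝ] ℝ) →L[ℝ] E) (z : E × (E →L[ℝ] ℝ)) : E × (E →L[ℝ] ℝ) :=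
  (P z.1 z.2, (-(1 / 2) : ℝ) • (z.2 ∘L ContinuousLinearMap.apply ℝ E z.2 ∘L fderiv ℝ P z.1))

lemma contDiffOn_hamiltonianField {P : E → (E →L[ℝ] ℝ) →L[ℝ] E} {Ω : Set E} (hΩ : IsOpen Ω)
    (hP : ContDiffOn ℝ ∞ P Ω) : ContDiffOn ℝ ∞ (hamiltonianField P) (Ω ×ˢ univ) := by
  have h1 : ContDiffOn ℝ ∞ (fun z : E × (E →L[ℝ] ℝ) ↦ P z.1) (Ω ×ˢ univ) :=
    hP.comp contDiffOn_fst fun z hz ↦ hz.1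
  have h2 : ContDiffOn ℝ ∞ (fun z : E × (E →L[ℝ] ℝ) ↦ fderiv ℝ P z.1) (Ω ×ˢ univ) :=
    (hP.fderiv_of_isOpen hΩ (m := ∞) (by simp)).comp contDiffOn_fst fun z hz ↦ hz.1
  have h3 : ContDiffOn ℝ ∞ (fun z : E × (E →L[ℝ] ℝ) ↦ ContinuousLinearMap.apply ℝ E z.2)
      (Ω ×ˢ univ) :=
    ((ContinuousLinearMap.apply ℝ E : (E →L[ℝ] ℝ) →L[ℝ] _).contDiff.comp
      contDiff_snd).contDiffOn
  exact (h1.clm_apply contDiffOn_snd).prodMk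
    ((contDiffOn_snd.clm_comp (h3.clm_comp h2)).const_smul _)

/-- The product rule gives three terms; symmetry of P merges the two that differentiate ϖ, whence
the factor 2. -/
lemma hasFDerivAt_quadratic {P : E → (E →L[ℝ] ℝ) →L[ℝ] E}
    {Ψ : F → E} {ϖ : F → E →L[ℝ] ℝ} {y : F}
    (hsymm : ∀ p q : E →L[ℝ] ℝ, p (P (Ψ y) q) = q (P (Ψ y) p))
    (hP : DifferentiableAt ℝ P (Ψ y)) (hΨ : DifferentiableAt ℝ Ψ y)
    (hϖ : DifferentiableAt ℝ ϖ y) (w : F) :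
    fderiv ℝ (fun y ↦ ϖ y (P (Ψ y) (ϖ y))) y w =
      2 * fderiv ℝ ϖ y w (P (Ψ y) (ϖ y)) + ϖ y (fderiv ℝ P (Ψ y) (fderiv ℝ Ψ y w) (ϖ y)) := by
  have h1 := hϖ.hasFDerivAt.clm_apply
    ((hP.hasFDerivAt.comp y hΨ.hasFDerivAt).clm_apply hϖ.hasFDerivAt)
  have h2 : fderiv ℝ (fun y ↦ ϖ y (P (Ψ y) (ϖ y))) y = _ := h1.fderiv
  rw [h2]
  simp [hsymm (ϖ y) (fderiv ℝ ϖ y w)]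
  ring

/-- The Hamiltonian is conserved along the flow. -/
lemma fderiv_hamiltonian_eq_zero {P : E → (E →L[ℝ] ℝ) →L[ℝ] E}
    {Ψ : F → E} {ϖ : F → E →L[ℝ] ℝ} {y ev : F}
    (hsymm : ∀ p q : E →L[ℝ] ℝ, p (P (Ψ y) q) = q (P (Ψ y) p))
    (hP : DifferentiableAt ℝ P (Ψ y)) (hΨ : DifferentiableAt ℝ Ψ y)
    (hϖ : DifferentiableAt ℝ ϖ y)
    (hflow : (fderiv ℝ Ψ y ev, fderiv ℝ ϖ y ev) = hamiltonianField P (Ψ y, ϖ y)) :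
    fderiv ℝ (fun y ↦ ϖ y (P (Ψ y) (ϖ y))) y ev = 0 := by
  rw [hasFDerivAt_quadratic hsymm hP hΨ hϖ]
  obtain ⟨h1, h2⟩ := Prod.mk.inj hflow
  rw [h1, h2]
  simp

/-- The pairing of the momentum with the derivative of a family of null solutions is conserved. -/
lemma fderiv_momentum_eq_zero {P : E → (E →L[ℝ] ℝ) →L[ℝ] E} {Ω : Set E} (hΩ : IsOpen Ω)
    (hP : ContDiffOn ℝ ∞ P Ω) (hsymm : ∀ x ∈ Ω, ∀ p q : E →L[ℝ] ℝ, p (P x q) = q (P x p))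
    {Ψ : F → E} {ϖ : F → E →L[ℝ] ℝ} {N : Set F} (hN : IsOpen N) (hΨ : ContDiffOn ℝ ∞ Ψ N)
    (hϖ : ContDiffOn ℝ ∞ ϖ N) (hΨΩ : MapsTo Ψ N Ω) {ev : F}
    (hflow : ∀ y ∈ N, (fderiv ℝ Ψ y ev, fderiv ℝ ϖ y ev) = hamiltonianField P (Ψ y, ϖ y))
    (hnull : ∀ y ∈ N, ϖ y (P (Ψ y) (ϖ y)) = 0) (w : F) {y : F} (hy : y ∈ N) :
    fderiv ℝ (fun y ↦ ϖ y (fderiv ℝ Ψ y w)) y ev = 0 := by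
  have hNy := hN.mem_nhds hy
  have hΨy := hΨ.contDiffAt hNy
  have dΨ : DifferentiableAt ℝ Ψ y := hΨy.differentiableAt (by simp)
  have dϖ : DifferentiableAt ℝ ϖ y := (hϖ.contDiffAt hNy).differentiableAt (by simp)
  have dP : DifferentiableAt ℝ P (Ψ y) :=
    (hP.contDiffAt (hΩ.mem_nhds (hΨΩ hy))).differentiableAt (by simp)
  have dDΨ : DifferentiableAt ℝ (fderiv ℝ Ψ) y :=
    ((hΨy.fderiv_right (m := ∞) (by simp)).differentiableAt (by simp))
  -- By symmetry of second derivatives, ∂_v∂_wΨ is obtained by differentiating the flow equation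
  -- ∂_vΨ = P ϖ in the direction w.
  have hmixed : fderiv ℝ (fderiv ℝ Ψ) y ev w =
      fderiv ℝ P (Ψ y) (fderiv ℝ Ψ y w) (ϖ y) + P (Ψ y) (fderiv ℝ ϖ y w) := by
    rw [(hΨy.isSymmSndFDerivAt (by
      rw [minSmoothness_of_isRCLikeNormedField]
      exact ENat.LEInfty.out)).eq ev w]
    have h1 : (fun z ↦ fderiv ℝ Ψ z ev) =ᶠ[𝓝 y] fun z ↦ P (Ψ z) (ϖ z) := by
      filter_upwards [hNy] with z hz using (Prod.mk.inj (hflow z hz)).1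
    have h2 : HasFDerivAt (fun z ↦ fderiv ℝ Ψ z ev) _ y :=
      dDΨ.hasFDerivAt.clm_apply (hasFDerivAt_const ev y)
    have h3 : HasFDerivAt (fun z ↦ P (Ψ z) (ϖ z)) _ y :=
      (dP.hasFDerivAt.comp y dΨ.hasFDerivAt).clm_apply dϖ.hasFDerivAt
    have h4 := DFunLike.congr_fun (h2.unique (h3.congr_of_eventuallyEq h1)) w
    simpa [add_comm] using h4
  have h5 : fderiv ℝ (fun y ↦ ϖ y (fderiv ℝ Ψ y w)) y ev =
      ϖ y (fderiv ℝ (fderiv ℝ Ψ) y ev w) + fderiv ℝ ϖ y ev (fderiv ℝ Ψ y w) := by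
    have h6 : HasFDerivAt (fun y ↦ ϖ y (fderiv ℝ Ψ y w)) _ y :=
      dϖ.hasFDerivAt.clm_apply (dDΨ.hasFDerivAt.clm_apply (hasFDerivAt_const w y))
    rw [h6.fderiv]
    simp
  have h7 : fderiv ℝ (fun y ↦ ϖ y (P (Ψ y) (ϖ y))) y w = 0 := by
    have : (fun y ↦ ϖ y (P (Ψ y) (ϖ y))) =ᶠ[𝓝 y] fun _ ↦ 0 := by
      filter_upwards [hNy] with z hz using hnull z hz
    rw [this.fderiv_eq]
    simp
  -- The momentum equation contributes -½ ϖ(DP(∂_wΨ) ϖ), so the total is exactly half of the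
  -- derivative in `h7`.
  rw [hasFDerivAt_quadratic (hsymm _ (hΨΩ hy)) dP dΨ dϖ] at h7
  rw [h5, hmixed, (Prod.mk.inj (hflow y hy)).2, map_add, hsymm _ (hΨΩ hy) (ϖ y) (fderiv ℝ ϖ y w)]
  simp
  linarith

/-- Convexity keeps the joining segment in N, where f has zero derivative. This carries conserved
quantities from the initial hypersurface to the whole box. -/
lemma eq_of_fderiv_apply_eq_zero {N : Set F} (hN : IsOpen N) (hconv : Convex ℝ N) {f : F → ℝ}
    (hf : DifferentiableOn ℝ f N) {v : F} (hv : ∀ y ∈ N, fderiv ℝ f y v = 0) {y : F} {t : ℝ}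
    (hy : y ∈ N) (hyt : y + t • v ∈ N) : f (y + t • v) = f y := by
  have hmem : ∀ s ∈ Icc (0 : ℝ) 1, y + s • t • v ∈ N := fun s hs ↦
    hconv.add_smul_mem hy hyt hs
  have hder : ∀ s ∈ Icc (0 : ℝ) 1, HasDerivAt (fun s : ℝ ↦ f (y + s • t • v)) 0 s := by
    intro s hs
    have h1 := (hf.differentiableAt (hN.mem_nhds (hmem s hs))).hasFDerivAt
    have h2 : HasDerivAt (fun s : ℝ ↦ y + s • t • v) (t • v) s := by
      simpa using ((hasDerivAt_id s).smul_const (t • v)).const_add y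
    have h3 := h1.comp_hasDerivAt s h2
    rw [map_smul, hv _ (hmem s hs), smul_zero] at h3
    exact h3
  have := constant_of_derivWithin_zero (f := fun s : ℝ ↦ f (y + s • t • v)) (a := 0) (b := 1)
    (fun s hs ↦ (hder s hs).differentiableAt.differentiableWithinAt)
    (fun s hs ↦ by
      rw [(hder s (Ico_subset_Icc_self hs)).hasDerivWithinAt.derivWithin]
      exact uniqueDiffOn_Icc_zero_one s (Ico_subset_Icc_self hs))
    1 (right_mem_Icc.2 zero_le_one)
  simpa using this

/-- Near a point where `l` is null and `l (P m) = 1`, the covector `l` can be corrected by a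
multiple of `m` to a smooth field of null covectors. -/
lemma exists_null_covector_field {P : E → (E →L[ℝ] ℝ) →L[ℝ] E} {Ω : Set E} (hΩ : IsOpen Ω)
    (hP : ContDiffOn ℝ ∞ P Ω) (hsymm : ∀ x ∈ Ω, ∀ p q : E →L[ℝ] ℝ, p (P x q) = q (P x p)) {x₀ : E}
    (hx₀ : x₀ ∈ Ω) {l m : E →L[ℝ] ℝ} (hl : l (P x₀ l) = 0) (hlm : l (P x₀ m) = 1) :
    ∃ (c : E → ℝ) (V : Set E), IsOpen V ∧ x₀ ∈ V ∧ V ⊆ Ω ∧ ContDiffOn ℝ ∞ c V ∧ c x₀ = 0 ∧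
      ∀ x ∈ V, (l + c x • m) (P x (l + c x • m)) = 0 := by
  have hpq : ∀ p q : E →L[ℝ] ℝ, ContDiffOn ℝ ∞ (fun x ↦ p (P x q)) Ω := fun p q ↦
    p.contDiff.comp_contDiffOn (hP.clm_apply contDiffOn_const)
  let D : E → ℝ := fun x ↦ l (P x m) ^ 2 - m (P x m) * l (P x l)
  have hD : ContDiffOn ℝ ∞ D Ω := ((hpq l m).pow 2).sub ((hpq m m).mul (hpq l l))
  let V : Set E := (Ω ∩ (fun x ↦ l (P x m)) ⁻¹' Ioi 0) ∩ (Ω ∩ D ⁻¹' Ioi 0)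
  have hVΩ : V ⊆ Ω := fun x hx ↦ hx.1.1
  have hpos : ∀ x ∈ V, 0 < l (P x m) + Real.sqrt (D x) := fun x hx ↦
    add_pos_of_pos_of_nonneg hx.1.2 (Real.sqrt_nonneg _)
  -- A root of the quadratic l(Pl) + 2c l(Pm) + c² m(Pm) in rationalized form: it stays smooth where
  -- the leading coefficient m(Pm) vanishes, and is 0 where l is already null. At x₀, both l(Pm) and
  -- D equal 1.
  refine ⟨fun x ↦ -(l (P x l)) / (l (P x m) + Real.sqrt (D x)), V,
    ((hpq l m).continuousOn.isOpen_inter_preimage hΩ isOpen_Ioi).inter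
      (hD.continuousOn.isOpen_inter_preimage hΩ isOpen_Ioi), ?_, hVΩ, ?_, ?_, ?_⟩
  · refine ⟨⟨hx₀, ?_⟩, hx₀, ?_⟩ <;> simp [D, hl, hlm]
  · refine ((hpq l l).mono hVΩ).neg.div (((hpq l m).mono hVΩ).add
      ((hD.mono hVΩ).sqrt fun x hx ↦ (show 0 < D x from hx.2.2).ne')) fun x hx ↦ (hpos x hx).ne'
  · simp [hl]
  · intro x hx
    have hs := Real.sq_sqrt (show 0 < D x from hx.2.2).le
    have hne := (hpos x hx).ne'
    simp only [add_apply, smul_apply, map_add, map_smul, D,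
      smul_eq_mul, hsymm x (hVΩ hx) m l]
    simp only [D] at hs
    generalize Real.sqrt (D x) = q at hs hne ⊢
    field_simp
    linear_combination (l (P x l)) * hs

end Hamiltonian

/-! ### The flow box of null solutions. -/

section NullFlow

open Filter Topology

/-- A map that is smooth near a point agrees near that point with a globally smooth map. -/
lemma ContDiffOn.exists_contDiff_eventuallyEq {X Y : Type*} [NormedAddCommGroup X]
    [NormedSpace ℝ X] [HasContDiffBump X] [NormedAddCommGroup Y] [NormedSpace ℝ Y] {f : X → Y}
    {U : Set X} (hU : IsOpen U) (hf : ContDiffOn ℝ ∞ f U) {a : X} (ha : a ∈ U) :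
    ∃ g : X → Y, ContDiff ℝ ∞ g ∧ g =ᶠ[𝓝 a] f := by
  obtain ⟨r, hr, hrU⟩ := Metric.isOpen_iff.1 hU a ha
  let χ : ContDiffBump a := ⟨r / 4, r / 2, by positivity, by linarith⟩
  have hsub : Metric.closedBall a (r / 2) ⊆ U :=
    (Metric.closedBall_subset_ball (by linarith)).trans hrU
  refine ⟨fun x ↦ χ x • f x, contDiff_iff_contDiffAt.2 fun x ↦ ?_, ?_⟩
  · by_cases hx : x ∈ Metric.closedBall a (r / 2)
    · exact χ.contDiffAt.smul (hf.contDiffAt (hU.mem_nhds (hsub hx)))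
    · have : (fun x ↦ χ x • f x) =ᶠ[𝓝 x] fun _ ↦ 0 := by
        filter_upwards [Metric.isClosed_closedBall.isOpen_compl.mem_nhds hx] with y hy
        rw [χ.zero_of_le_dist (not_le.1 (Metric.mem_closedBall.not.1 hy)).le, zero_smul]
      exact contDiffAt_const.congr_of_eventuallyEq this
  · filter_upwards [χ.eventuallyEq_one] with x hx
    simp [hx]

/-- Solutions of an ordinary differential equation issuing from a hyperplane of initial values,
put together to a smooth map on a box. -/
lemma exists_flow_box {X : Type*} {F : Type*} [NormedAddCommGroup X] [NormedSpace ℝ X]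
    [CompleteSpace X] [NormedAddCommGroup F] [NormedSpace ℝ F] {f : X → X} (hf : ContDiff ℝ ∞ f)
    {ev : F} {τ : F →L[ℝ] ℝ} (hτ : τ ev = 1) {s : F → X} {V : Set F} (hV : IsOpen V)
    (h0V : 0 ∈ V) (hs : ContDiffOn ℝ ∞ s V) {W : Set X} (hW : IsOpen W) (hsW : s 0 ∈ W) :
    ∃ (N : Set F) (Φ : F → X), IsOpen N ∧ Convex ℝ N ∧ 0 ∈ N ∧
      (∀ y ∈ N, y - τ y • ev ∈ N) ∧ ContDiffOn ℝ ∞ Φ N ∧ MapsTo Φ N W ∧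
      (∀ y ∈ N, fderiv ℝ Φ y ev = f (Φ y)) ∧ ∀ y ∈ N, τ y = 0 → y ∈ V ∧ Φ y = s y := by
  obtain ⟨φ, U, hU, h0U, hφ, hφ0, hφ'⟩ := exists_contDiffOn_flow hf (s 0)
  let pr : F →L[ℝ] F := ContinuousLinearMap.id ℝ F - τ.smulRight ev
  have hpr : ∀ y, pr y = y - τ y • ev := fun y ↦ rfl
  have hprpr : ∀ y, pr (pr y) = pr y := fun y ↦ by simp [hpr, hτ]
  have hτpr : ∀ y, τ (pr y) = 0 := fun y ↦ by simp [hpr, hτ]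
  let j : F → ℝ × X := fun y ↦ (τ y, s (pr y))
  have hj : ContDiffOn ℝ ∞ j (pr ⁻¹' V) :=
    τ.contDiff.contDiffOn.prodMk (hs.comp pr.contDiff.contDiffOn fun y hy ↦ hy)
  have hN₁ : IsOpen (pr ⁻¹' V ∩ j ⁻¹' U) :=
    hj.continuousOn.isOpen_inter_preimage (hV.preimage pr.continuous) hU
  let Φ : F → X := fun y ↦ φ (j y)
  have hΦ : ContDiffOn ℝ ∞ Φ (pr ⁻¹' V ∩ j ⁻¹' U) :=
    hφ.comp (hj.mono inter_subset_left) fun y hy ↦ hy.2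
  have hN₀ : IsOpen ((pr ⁻¹' V ∩ j ⁻¹' U) ∩ Φ ⁻¹' W) :=
    hΦ.continuousOn.isOpen_inter_preimage hN₁ hW
  -- T splits a vector into its time and its projection to the hyperplane τ = 0. The preimage of a
  -- ball for the max norm is a box: convex, and stable under the projection.
  let T : F →L[ℝ] ℝ × F := τ.prod pr
  let R : ℝ × F →L[ℝ] F :=
    ContinuousLinearMap.snd ℝ ℝ F + (ContinuousLinearMap.fst ℝ ℝ F).smulRight ev
  have hRT : ∀ y, R (T y) = y := fun y ↦ by simp [R, T, hpr]
  have hj0 : j 0 = (0, s 0) := by simp [j]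
  have h0N₀ : (0 : F) ∈ (pr ⁻¹' V ∩ j ⁻¹' U) ∩ Φ ⁻¹' W := by
    refine ⟨⟨by simpa using h0V, ?_⟩, ?_⟩
    · rw [mem_preimage, hj0]; exact h0U
    · show φ (j 0) ∈ W
      rw [hj0, hφ0 _ h0U]; exact hsW
  obtain ⟨δ, hδ, hδN⟩ := Metric.isOpen_iff.1 (hN₀.preimage R.continuous) 0 (by simpa using h0N₀)
  have hsub : T ⁻¹' Metric.ball 0 δ ⊆ (pr ⁻¹' V ∩ j ⁻¹' U) ∩ Φ ⁻¹' W := fun y hy ↦ by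
    have := hδN hy
    rwa [mem_preimage, hRT] at this
  have hNo : IsOpen (T ⁻¹' Metric.ball 0 δ) := Metric.isOpen_ball.preimage T.continuous
  refine ⟨T ⁻¹' Metric.ball 0 δ, Φ, hNo,
    (convex_ball _ _).linear_preimage T.toLinearMap, by simpa using hδ, ?_,
    hΦ.mono (hsub.trans inter_subset_left), fun y hy ↦ (hsub hy).2, ?_, ?_⟩
  · intro y hy
    rw [← hpr, mem_preimage, mem_ball_zero_iff, Prod.norm_def, max_lt_iff]
    rw [mem_preimage, mem_ball_zero_iff, Prod.norm_def, max_lt_iff] at hy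
    refine ⟨?_, ?_⟩
    · show ‖τ (pr y)‖ < δ
      rwa [hτpr, norm_zero]
    · show ‖pr (pr y)‖ < δ
      rw [hprpr]; exact hy.2
  · intro y hy
    have h1 : HasFDerivAt Φ (fderiv ℝ Φ y) y :=
      ((hΦ.contDiffAt (hN₁.mem_nhds (hsub hy).1)).differentiableAt (by simp)).hasFDerivAt
    have h2 : HasDerivAt (fun t : ℝ ↦ y + (t - τ y) • ev) ev (τ y) := by
      simpa using (((hasDerivAt_id (τ y)).sub_const (τ y)).smul_const ev).const_add y
    have h3 : HasDerivAt (fun t : ℝ ↦ Φ (y + (t - τ y) • ev)) (fderiv ℝ Φ y ev) (τ y) := by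
      refine HasFDerivAt.comp_hasDerivAt (f := fun t : ℝ ↦ y + (t - τ y) • ev) (l := Φ) (τ y) ?_ h2
      simpa using h1
    -- Along a line in direction ev the initial point is constant and only the time varies, so Φ
    -- restricts there to one solution curve.
    have h5 : ∀ t : ℝ, pr (y + (t - τ y) • ev) = pr y := fun t ↦ by
      rw [hpr, hpr, map_add, map_smul τ, hτ, smul_eq_mul, mul_one, add_sub_cancel, sub_smul]
      abel
    have h4 : (fun t : ℝ ↦ Φ (y + (t - τ y) • ev)) = fun t ↦ φ (t, s (pr y)) := by
      funext t
      simp only [Φ, j, h5]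
      simp [hτ]
    rw [h4] at h3
    exact h3.unique (hφ' _ _ (hsub hy).1.2)
  · intro y hy hy0
    have h5 : pr y = y := by simp [hpr, hy0]
    have h6 := (hsub hy).1
    refine ⟨by simpa [h5] using h6.1, ?_⟩
    have h7 := h6.2
    simp only [mem_preimage, j, hy0, h5] at h7
    simp only [Φ, j, hy0, h5]
    exact hφ0 _ h7

/-- Null coordinates for a Hamiltonian `½ p (P x p)`, adapted to a given null solution. -/
theorem exists_null_flow_map {E F : Type*} [NormedAddCommGroup E] [NormedSpace ℝ E]
    [FiniteDimensional ℝ E] [NormedAddCommGroup F] [NormedSpace ℝ F]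
    {P : E → (E →L[ℝ] ℝ) →L[ℝ] E} {Ω : Set E} (hΩ : IsOpen Ω)
    (hP : ContDiffOn ℝ ∞ P Ω) (hsymm : ∀ x ∈ Ω, ∀ p q : E →L[ℝ] ℝ, p (P x q) = q (P x p))
    {x₀ : E} (hx₀ : x₀ ∈ Ω) {ev : F} {τ : F →L[ℝ] ℝ} (hτ : τ ev = 1) (L : F ≃L[ℝ] E)
    {l m : E →L[ℝ] ℝ} (hm : ∀ y, m (L y) = τ y) (hl : P x₀ l = L ev) (hlv : l (L ev) = 0)
    {z : ℝ → E × (E →L[ℝ] ℝ)} (hz : ∀ᶠ t in 𝓝 0, HasDerivAt z (hamiltonianField P (z t)) t)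
    (hz0 : z 0 = (x₀, l)) :
    ∃ (N : Set F) (Ψ : F → E) (ϖ : F → E →L[ℝ] ℝ), IsOpen N ∧ 0 ∈ N ∧ ContDiffOn ℝ ∞ Ψ N ∧
      MapsTo Ψ N Ω ∧ (∀ y ∈ N, fderiv ℝ Ψ y ev = P (Ψ y) (ϖ y)) ∧
      (∀ y ∈ N, ∀ w, ϖ y (fderiv ℝ Ψ y w) = l (L w)) ∧
      fderiv ℝ Ψ 0 = (L : F →L[ℝ] E) ∧ ∀ᶠ t : ℝ in 𝓝 0, Ψ (t • ev) = (z t).1 := by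
  obtain ⟨c, V, hV, hxV, hVΩ, hc, hc0, hcnull⟩ := exists_null_covector_field hΩ hP hsymm hx₀
    (l := l) (m := m) (by rw [hl, hlv]) (by rw [hsymm _ hx₀, hl, hm, hτ])
  obtain ⟨f, hf, hfeq⟩ := (contDiffOn_hamiltonianField hΩ hP).exists_contDiff_eventuallyEq
    (hΩ.prod isOpen_univ) (a := (x₀, l)) ⟨hx₀, mem_univ _⟩
  obtain ⟨W₀, hW₀f, hW₀, hxW₀⟩ := eventually_nhds_iff.1 hfeq
  -- f is a globally smooth replacement of the Hamiltonian field; solutions staying in W do not see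
  -- the difference.
  let W : Set (E × (E →L[ℝ] ℝ)) := W₀ ∩ Ω ×ˢ univ
  have hW : IsOpen W := hW₀.inter (hΩ.prod isOpen_univ)
  have hxW : (x₀, l) ∈ W := ⟨hxW₀, hx₀, mem_univ _⟩
  let a : F → E := fun y ↦ x₀ + L y
  have ha : ContDiff ℝ ∞ a := contDiff_const.add L.contDiff
  -- Since m ∘ L = τ vanishes on the initial hyperplane, the correction by m makes the covector null
  -- without changing its values on tangent vectors of that hyperplane.
  let s : F → E × (E →L[ℝ] ℝ) := fun y ↦ (a y, l + c (a y) • m)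
  have hs : ContDiffOn ℝ ∞ s (a ⁻¹' V) :=
    ha.contDiffOn.prodMk (contDiffOn_const.add
      ((hc.comp ha.contDiffOn fun y hy ↦ hy).smul contDiffOn_const))
  have ha0 : a 0 = x₀ := by simp [a]
  have hs0 : s 0 = (x₀, l) := by simp [s, ha0, hc0]
  obtain ⟨N, Φ, hN, hNc, h0N, hNpr, hΦ, hΦW, hΦ', hΦs⟩ := exists_flow_box hf hτ
    (hV.preimage ha.continuous) (by rw [mem_preimage, ha0]; exact hxV) hs hW (by rwa [hs0])
  have hΨ : ContDiffOn ℝ ∞ (fun y ↦ (Φ y).1) N := contDiff_fst.comp_contDiffOn hΦ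
  have hϖ : ContDiffOn ℝ ∞ (fun y ↦ (Φ y).2) N := contDiff_snd.comp_contDiffOn hΦ
  have hΨΩ : MapsTo (fun y ↦ (Φ y).1) N Ω := fun y hy ↦ (hΦW hy).2.1
  have hflow : ∀ y ∈ N, (fderiv ℝ (fun y ↦ (Φ y).1) y ev, fderiv ℝ (fun y ↦ (Φ y).2) y ev) =
      hamiltonianField P ((Φ y).1, (Φ y).2) := by
    intro y hy
    have h1 : DifferentiableAt ℝ Φ y :=
      (hΦ.contDiffAt (hN.mem_nhds hy)).differentiableAt (by simp)
    have h2 : fderiv ℝ Φ y ev = hamiltonianField P (Φ y) := by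
      rw [hΦ' y hy, hW₀f _ (hΦW hy).1]
    rw [h1.hasFDerivAt.fst.fderiv, h1.hasFDerivAt.snd.fderiv, Prod.mk.eta, ← h2]
    rfl
  have hbase : ∀ y ∈ N, y = (y - τ y • ev) + τ y • ev := fun y _ ↦ by abel
  have hτbase : ∀ y, τ (y - τ y • ev) = 0 := fun y ↦ by simp [hτ]
  have hdP : ∀ y ∈ N, DifferentiableAt ℝ P (Φ y).1 := fun y hy ↦
    (hP.contDiffAt (hΩ.mem_nhds (hΨΩ hy))).differentiableAt (by simp)
  have hdΨ : ∀ y ∈ N, DifferentiableAt ℝ (fun y ↦ (Φ y).1) y := fun y hy ↦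
    (hΨ.contDiffAt (hN.mem_nhds hy)).differentiableAt (by simp)
  have hdϖ : ∀ y ∈ N, DifferentiableAt ℝ (fun y ↦ (Φ y).2) y := fun y hy ↦
    (hϖ.contDiffAt (hN.mem_nhds hy)).differentiableAt (by simp)
  have hnull : ∀ y ∈ N, (Φ y).2 (P (Φ y).1 (Φ y).2) = 0 := by
    intro y hy
    have h1 : DifferentiableOn ℝ (fun y ↦ (Φ y).2 (P (Φ y).1 (Φ y).2)) N := fun y hy ↦
      ((hdϖ y hy).clm_apply (((hdP y hy).comp y (hdΨ y hy)).clm_apply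
        (hdϖ y hy))).differentiableWithinAt
    have h2 := eq_of_fderiv_apply_eq_zero hN hNc h1 (v := ev)
      (fun y hy ↦ fderiv_hamiltonian_eq_zero (hsymm _ (hΨΩ hy)) (hdP y hy) (hdΨ y hy)
        (hdϖ y hy) (hflow y hy)) (hNpr y hy) (t := τ y) (by rwa [← hbase y hy])
    rw [← hbase y hy] at h2
    obtain ⟨h3, h4⟩ := hΦs _ (hNpr y hy) (hτbase y)
    rw [h2, h4]
    exact hcnull _ h3
  have hslice : ∀ y ∈ N, τ y = 0 → ∀ w, τ w = 0 → fderiv ℝ (fun y ↦ (Φ y).1) y w = L w := by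
    intro y hy hy0 w hw
    have h2 : HasDerivAt (fun t : ℝ ↦ y + t • w) w 0 := by
      simpa using ((hasDerivAt_id (0 : ℝ)).smul_const w).const_add y
    have h3 : HasDerivAt (fun t : ℝ ↦ (Φ (y + t • w)).1) (fderiv ℝ (fun y ↦ (Φ y).1) y w) 0 := by
      refine HasFDerivAt.comp_hasDerivAt (f := fun t : ℝ ↦ y + t • w)
        (l := fun y ↦ (Φ y).1) 0 ?_ h2
      simpa using (hdΨ y hy).hasFDerivAt
    have h4 : HasDerivAt (fun t : ℝ ↦ a (y + t • w)) (L w) 0 := by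
      have : (fun t : ℝ ↦ a (y + t • w)) = fun t ↦ a y + t • L w := by
        funext t; simp [a, add_assoc]
      rw [this]
      simpa using ((hasDerivAt_id (0 : ℝ)).smul_const (L w)).const_add (a y)
    refine h3.unique (h4.congr_of_eventuallyEq ?_)
    have h5 : ∀ᶠ t : ℝ in 𝓝 0, y + t • w ∈ N := by
      have : ContinuousAt (fun t : ℝ ↦ y + t • w) 0 := by fun_prop
      exact this (hN.mem_nhds (by simpa using hy))
    filter_upwards [h5] with t ht
    rw [(hΦs _ ht (by simp [hy0, hw])).2]
  refine ⟨N, fun y ↦ (Φ y).1, fun y ↦ (Φ y).2, hN, h0N, hΨ, hΨΩ,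
    fun y hy ↦ (Prod.mk.inj (hflow y hy)).1, ?_, ?_, ?_⟩
  · intro y hy
    have hver : (Φ y).2 (fderiv ℝ (fun y ↦ (Φ y).1) y ev) = 0 := by
      rw [(Prod.mk.inj (hflow y hy)).1]
      exact hnull y hy
    have hhor : ∀ w, τ w = 0 → (Φ y).2 (fderiv ℝ (fun y ↦ (Φ y).1) y w) = l (L w) := by
      intro w hw
      have h1 : DifferentiableOn ℝ (fun y ↦ (Φ y).2 (fderiv ℝ (fun y ↦ (Φ y).1) y w)) N :=
        ((hϖ.clm_apply ((hΨ.fderiv_of_isOpen hN (m := ∞) (by simp)).clm_apply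
          contDiffOn_const)).differentiableOn (by simp))
      have h2 := eq_of_fderiv_apply_eq_zero hN hNc h1 (v := ev)
        (fun y hy ↦ fderiv_momentum_eq_zero hΩ hP hsymm hN hΨ hϖ hΨΩ hflow hnull w hy)
        (hNpr y hy) (t := τ y) (by rwa [← hbase y hy])
      rw [← hbase y hy] at h2
      rw [h2, hslice _ (hNpr y hy) (hτbase y) w hw, (hΦs _ (hNpr y hy) (hτbase y)).2]
      simp [s, hm, hw]
    -- w is split into a multiple of ev, on which both sides vanish because ϖ and l are null, and a
    -- part tangent to the hyperplane, where the conserved pairing keeps its initial value.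
    intro w
    have h1 : w = (w - τ w • ev) + τ w • ev := by abel
    rw [h1, map_add, map_add, map_smul, map_smul, hver, hhor _ (hτbase w), map_add, map_add,
      map_smul, map_smul, hlv]
  · ext w
    have h1 : w = (w - τ w • ev) + τ w • ev := by abel
    have h2 : fderiv ℝ (fun y ↦ (Φ y).1) 0 ev = L ev := by
      rw [(Prod.mk.inj (hflow 0 h0N)).1, (hΦs 0 h0N (by simp)).2, hs0, hl]
    rw [h1, map_add, map_smul, h2, hslice 0 h0N (by simp) _ (hτbase w)]
    simp
  -- t ↦ Φ (t • ev) and z solve the same equation with the same initial value, and f, being C¹, is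
  -- locally Lipschitz.
  · obtain ⟨K, u, hu, hK⟩ := ((hf.contDiffAt (x := (x₀, l))).of_le (m := 1)
      (by simp)).exists_lipschitzOnWith
    have hzc : ContinuousAt z 0 := hz.self_of_nhds.continuousAt
    have hcv : ContinuousAt (fun t : ℝ ↦ Φ (t • ev)) 0 := by
      refine ContinuousAt.comp (f := fun t : ℝ ↦ t • ev) (g := Φ) ?_ (by fun_prop)
      simpa using (hΦ.contDiffAt (hN.mem_nhds h0N)).continuousAt
    have hΦ0 : Φ 0 = (x₀, l) := by rw [(hΦs 0 h0N (by simp)).2, hs0]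
    have hNt : ∀ᶠ t : ℝ in 𝓝 0, t • ev ∈ N := by
      have : ContinuousAt (fun t : ℝ ↦ t • ev) 0 := by fun_prop
      exact this (hN.mem_nhds (by simpa using h0N))
    have hWt : ∀ᶠ t in 𝓝 0, z t ∈ W₀ := hzc (by rw [hz0]; exact hW₀.mem_nhds hxW₀)
    have hcurve := ODE_solution_unique_of_eventually (t₀ := 0) (v := fun _ ↦ f) (s := fun _ ↦ u)
      (f := fun t : ℝ ↦ Φ (t • ev)) (g := z) (Eventually.of_forall fun _ ↦ hK) ?_ ?_
      (by rw [zero_smul, hΦ0, hz0])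
    · filter_upwards [hcurve] with t ht
      exact congrArg Prod.fst ht
    · have hut : ∀ᶠ t : ℝ in 𝓝 0, Φ (t • ev) ∈ u := hcv (by simpa [hΦ0] using hu)
      filter_upwards [hut, hNt] with t ht htN
      refine ⟨?_, ht⟩
      rw [← hΦ' _ htN]
      refine HasFDerivAt.comp_hasDerivAt (f := fun t : ℝ ↦ t • ev) (l := Φ) t
        ((hΦ.contDiffAt (hN.mem_nhds htN)).differentiableAt (by simp)).hasFDerivAt ?_
      simpa using (hasDerivAt_id t).smul_const ev
    · have hut : ∀ᶠ t in 𝓝 0, z t ∈ u := hzc (by rwa [hz0])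
      filter_upwards [hut, hz, hWt] with t ht hzt htW
      exact ⟨by rwa [hW₀f _ htW], ht⟩

end NullFlow

/-! ### Null coordinates for a metric on an open subset of coordinate space. -/

section LocalNullCoordinates

open Filter Topology

/-- A symmetric matrix close enough to the identity is positive definite. -/
lemma Matrix.posDef_of_abs_sub_one_lt {m : ℕ} {A : Matrix (Fin m) (Fin m) ℝ} (hA : A.IsSymm)
    (h : ∀ a b, |A a b - (1 : Matrix (Fin m) (Fin m) ℝ) a b| < 1 / (m + 1)) : A.PosDef := by
  refine Matrix.PosDef.of_dotProduct_mulVec_pos ?_ fun x hx ↦ ?_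
  · rw [Matrix.IsHermitian, Matrix.conjTranspose_eq_transpose_of_trivial]
    exact hA
  · have hpos : 0 < ∑ a, x a ^ 2 := by
      obtain ⟨a, ha⟩ := Function.ne_iff.1 hx
      exact Finset.sum_pos' (fun a _ ↦ sq_nonneg _) ⟨a, Finset.mem_univ a, sq_pos_iff.2 ha⟩
    have h1 : star x ⬝ᵥ A.mulVec x =
        ∑ a, x a ^ 2 + ∑ a, ∑ b, x a * (A a b - (1 : Matrix (Fin m) (Fin m) ℝ) a b) * x b := by
      have h2 : ∑ a, x a ^ 2 = ∑ a, ∑ b, x a * (1 : Matrix (Fin m) (Fin m) ℝ) a b * x b := by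
        refine Finset.sum_congr rfl fun a _ ↦ ?_
        simp [Matrix.one_apply, sq]
      rw [h2, ← Finset.sum_add_distrib]
      simp only [dotProduct, Matrix.mulVec, star_trivial]
      refine Finset.sum_congr rfl fun a _ ↦ ?_
      rw [← Finset.sum_add_distrib, Finset.mul_sum]
      exact Finset.sum_congr rfl fun b _ ↦ by ring
    -- Cauchy-Schwarz bounds (∑ |x a|)² by m ∑ (x a)². The bound 1 / (m + 1) then leaves a factor m
    -- / (m + 1) < 1, and is meaningful for m = 0.
    have h3 : |∑ a, ∑ b, x a * (A a b - (1 : Matrix (Fin m) (Fin m) ℝ) a b) * x b| ≤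
        1 / (m + 1) * (m * ∑ a, x a ^ 2) := by
      calc _ ≤ ∑ a, ∑ b, |x a| * (1 / (m + 1)) * |x b| := by
            refine (Finset.abs_sum_le_sum_abs _ _).trans (Finset.sum_le_sum fun a _ ↦ ?_)
            refine (Finset.abs_sum_le_sum_abs _ _).trans (Finset.sum_le_sum fun b _ ↦ ?_)
            rw [abs_mul, abs_mul]
            gcongr
            exact (h a b).le
        _ = 1 / (m + 1) * (∑ a, |x a|) ^ 2 := by
            rw [sq, Finset.sum_mul_sum, Finset.mul_sum]
            refine Finset.sum_congr rfl fun a _ ↦ ?_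
            rw [Finset.mul_sum]
            exact Finset.sum_congr rfl fun b _ ↦ by ring
        _ ≤ _ := by
            gcongr
            simpa using sq_sum_le_card_mul_sum_sq (s := Finset.univ) (f := fun a ↦ |x a|)
    have h4 : 1 / (m + 1) * (m * ∑ a, x a ^ 2) < ∑ a, x a ^ 2 := by
      rw [one_div, inv_mul_lt_iff₀ (by positivity)]
      nlinarith
    rw [h1]
    linarith [(abs_le.1 h3).1]

variable {E : Type*} [NormedAddCommGroup E] [NormedSpace ℝ E]

lemma contDiffOn_inverse [CompleteSpace E] {G : Type*} [NormedAddCommGroup G] [NormedSpace ℝ G]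
    {B : E → E →L[ℝ] G} {Ω : Set E} (hΩ : IsOpen Ω) (hB : ContDiffOn ℝ ∞ B Ω)
    (hinv : ∀ x ∈ Ω, (B x).IsInvertible) : ContDiffOn ℝ ∞ (fun x ↦ (B x).inverse) Ω := by
  intro x hx
  obtain ⟨e, he⟩ := hinv x hx
  refine ContDiffAt.contDiffWithinAt ?_
  have h1 : ContDiffAt ℝ ∞ ContinuousLinearMap.inverse (B x) := by
    rw [← he]; exact contDiffAt_map_inverse e
  exact h1.comp x (hB.contDiffAt (hΩ.mem_nhds hx))

/-- The Euler-Lagrange equations of `½ B(x)(ẋ, ẋ)`, in Hamiltonian form. -/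
lemma hamiltonianField_inverse_eq [CompleteSpace E] {B : E → E →L[ℝ] E →L[ℝ] ℝ} {Ω : Set E}
    (hΩ : IsOpen Ω) (hB : ContDiffOn ℝ ∞ B Ω) (hinv : ∀ x ∈ Ω, (B x).IsInvertible)
    (hsymm : ∀ x ∈ Ω, ∀ v w, B x v w = B x w v) {x : E} (hx : x ∈ Ω) (v : E) {p' : E →L[ℝ] ℝ}
    (hp' : ∀ w, p' w = 1 / 2 * fderiv ℝ B x w v v) :
    hamiltonianField (fun x ↦ (B x).inverse) (x, B x v) = (v, p') := by
  have hleft : ∀ y ∈ Ω, ∀ u, (B y).inverse (B y u) = u := fun y hy u ↦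
    (hinv y hy).inverse_apply_eq.2 rfl
  have hright : ∀ y ∈ Ω, ∀ p, B y ((B y).inverse p) = p := fun y hy p ↦
    ((hinv y hy).inverse_apply_eq.1 rfl).symm
  refine Prod.ext (hleft x hx v) ?_
  ext w
  have hdP : DifferentiableAt ℝ (fun x ↦ (B x).inverse) x :=
    ((contDiffOn_inverse hΩ hB hinv).contDiffAt (hΩ.mem_nhds hx)).differentiableAt (by simp)
  have hdB : DifferentiableAt ℝ B x :=
    (hB.contDiffAt (hΩ.mem_nhds hx)).differentiableAt (by simp)
  have h1 : HasFDerivAt (fun y ↦ (B y).inverse (B y v)) _ x :=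
    hdP.hasFDerivAt.clm_apply (hdB.hasFDerivAt.clm_apply (hasFDerivAt_const v x))
  have h2 : HasFDerivAt (fun y ↦ (B y).inverse (B y v)) (0 : E →L[ℝ] E) x := by
    refine (hasFDerivAt_const v x).congr_of_eventuallyEq ?_
    filter_upwards [hΩ.mem_nhds hx] with y hy using hleft y hy v
  have h3 := DFunLike.congr_fun (h1.unique h2) w
  -- Obtained by differentiating the identity B⁻¹(B v) = v with v fixed. The sign turns -½ p(DP p)
  -- into +½ DB(v, v).
  have h4 : fderiv ℝ (fun x ↦ (B x).inverse) x w (B x v) = -(B x).inverse (fderiv ℝ B x w v) := by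
    refine eq_neg_of_add_eq_zero_right ?_
    simpa using h3
  simp only [hamiltonianField, smul_apply, ContinuousLinearMap.comp_apply,
    ContinuousLinearMap.apply_apply, h4, map_neg, smul_eq_mul]
  rw [hp', hsymm x hx v, hright x hx]
  ring

/-- Null coordinates for a metric on an open subset of coordinate space, adapted to a null
geodesic. -/
theorem exists_null_coordinates_local {m : ℕ} {Ω : Set (EuclideanSpace ℝ (Fin (m + 2)))}
    (hΩ : IsOpen Ω)
    {B : EuclideanSpace ℝ (Fin (m + 2)) → EuclideanSpace ℝ (Fin (m + 2)) →L[ℝ]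
      EuclideanSpace ℝ (Fin (m + 2)) →L[ℝ] ℝ}
    (hB : ContDiffOn ℝ ∞ B Ω) (hinv : ∀ x ∈ Ω, (B x).IsInvertible)
    (hsymm : ∀ x ∈ Ω, ∀ v w, B x v w = B x w v)
    {x v : ℝ → EuclideanSpace ℝ (Fin (m + 2))} {t₀ : ℝ} (hx₀ : x t₀ ∈ Ω)
    (hx : ∀ᶠ t in 𝓝 t₀, HasDerivAt x (v t) t)
    (hv : ∀ᶠ t in 𝓝 t₀, ∃ p' : EuclideanSpace ℝ (Fin (m + 2)) →L[ℝ] ℝ,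
      HasDerivAt (fun s ↦ B (x s) (v s)) p' t ∧
        ∀ w, p' w = 1 / 2 * fderiv ℝ B (x t) w (v t) (v t))
    (L : EuclideanSpace ℝ (Fin (m + 2)) ≃L[ℝ] EuclideanSpace ℝ (Fin (m + 2)))
    (hL : L (EuclideanSpace.single 1 1) = v t₀) (hLv : ∀ w, B (x t₀) (v t₀) (L w) = w 0)
    (hLx : ∀ a b : Fin m, B (x t₀) (L (EuclideanSpace.single (xIdx a) 1))
      (L (EuclideanSpace.single (xIdx b) 1)) = if a = b then 1 else 0) :
    ∃ (e : OpenPartialHomeomorph (EuclideanSpace ℝ (Fin (m + 2)))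
        (EuclideanSpace ℝ (Fin (m + 2)))) (r : ℝ), 0 < r ∧ e.source = Metric.ball 0 r ∧
      e.target ⊆ Ω ∧ ContDiffOn ℝ ∞ e e.source ∧ ContDiffOn ℝ ∞ e.symm e.target ∧
      (∀ y ∈ e.source, ∀ w, B (e y) (fderiv ℝ e y (EuclideanSpace.single 1 1))
        (fderiv ℝ e y w) = w 0) ∧
      (∀ y ∈ e.source, (Matrix.of fun a b : Fin m ↦
        B (e y) (fderiv ℝ e y (EuclideanSpace.single (xIdx a) 1))
          (fderiv ℝ e y (EuclideanSpace.single (xIdx b) 1))).PosDef) ∧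
      ∀ t : ℝ, t • EuclideanSpace.single 1 1 ∈ e.source →
        e (t • EuclideanSpace.single 1 1) = x (t₀ + t) := by
  have hright : ∀ y ∈ Ω, ∀ p, B y ((B y).inverse p) = p := fun y hy p ↦
    ((hinv y hy).inverse_apply_eq.1 rfl).symm
  have hleft : ∀ y ∈ Ω, ∀ u, (B y).inverse (B y u) = u := fun y hy u ↦
    (hinv y hy).inverse_apply_eq.2 rfl
  let ev : EuclideanSpace ℝ (Fin (m + 2)) := EuclideanSpace.single 1 1
  let τ : EuclideanSpace ℝ (Fin (m + 2)) →L[ℝ] ℝ := EuclideanSpace.proj 1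
  have hτ : τ ev = 1 := by simp [τ, ev]
  -- The v-component read in the frame L, so that μ ∘ L = τ.
  let μ : EuclideanSpace ℝ (Fin (m + 2)) →L[ℝ] ℝ := τ ∘L L.symm.toContinuousLinearMap
  let l := B (x t₀) (v t₀)
  let z : ℝ → EuclideanSpace ℝ (Fin (m + 2)) × (EuclideanSpace ℝ (Fin (m + 2)) →L[ℝ] ℝ) :=
    fun t ↦ (x (t₀ + t), B (x (t₀ + t)) (v (t₀ + t)))
  have hshift : Tendsto (fun t : ℝ ↦ t₀ + t) (𝓝 0) (𝓝 t₀) := by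
    have : ContinuousAt (fun t : ℝ ↦ t₀ + t) 0 := by fun_prop
    simpa [ContinuousAt] using this
  have hxΩ : ∀ᶠ t in 𝓝 t₀, x t ∈ Ω := hx.self_of_nhds.continuousAt (hΩ.mem_nhds hx₀)
  have hz : ∀ᶠ t in 𝓝 0, HasDerivAt z (hamiltonianField (fun x ↦ (B x).inverse) (z t)) t := by
    filter_upwards [hshift.eventually hx, hshift.eventually hv, hshift.eventually hxΩ] with
      t hxt ⟨p', hvt, hp'⟩ hΩt
    rw [hamiltonianField_inverse_eq hΩ hB hinv hsymm hΩt _ hp']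
    exact (hxt.comp_const_add t₀ t).prodMk (hvt.comp_const_add t₀ t)
  obtain ⟨N, Ψ, ϖ, hN, h0N, hΨ, hΨΩ, hΨv, hϖ, hΨ0, hcurve⟩ := exists_null_flow_map hΩ
    (contDiffOn_inverse hΩ hB hinv) (fun y hy p q ↦ by
      conv_lhs => rw [← hright y hy p]
      conv_rhs => rw [← hright y hy q]
      rw [hsymm y hy]) hx₀ hτ L
    (l := l) (m := μ) (by simp [μ]) (by rw [hL]; exact hleft _ hx₀ _)
    (by rw [hLv]; simp [ev]) hz (by simp [z, l])
  have hfd0 : HasFDerivAt Ψ (L : _ →L[ℝ] EuclideanSpace ℝ (Fin (m + 2))) 0 := by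
    rw [← hΨ0]
    exact ((hΨ.contDiffAt (hN.mem_nhds h0N)).differentiableAt (by simp)).hasFDerivAt
  obtain ⟨e, h0e, heN, heΨ, hesymm⟩ := hΨ.exists_openPartialHomeomorph hN h0N L hfd0
  have hΨ00 : Ψ 0 = x t₀ := by simpa [z] using hcurve.self_of_nhds
  let h : Fin m → Fin m → EuclideanSpace ℝ (Fin (m + 2)) → ℝ := fun a b y ↦
    B (Ψ y) (fderiv ℝ Ψ y (EuclideanSpace.single (xIdx a) 1))
      (fderiv ℝ Ψ y (EuclideanSpace.single (xIdx b) 1))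
  have hh : ∀ a b, ContinuousOn (h a b) N := fun a b ↦ by
    have h1 : ContDiffOn ℝ ∞ (fderiv ℝ Ψ) N := hΨ.fderiv_of_isOpen hN (by simp)
    exact (((hB.comp hΨ hΨΩ).clm_apply (h1.clm_apply contDiffOn_const)).clm_apply
      (h1.clm_apply contDiffOn_const)).continuousOn
  have hpd : ∀ᶠ y in 𝓝 0, ∀ a b, |h a b y - (1 : Matrix (Fin m) (Fin m) ℝ) a b| <
      1 / (m + 1) := by
    refine eventually_all.2 fun a ↦ eventually_all.2 fun b ↦ ?_
    have h1 : ContinuousAt (fun y ↦ |h a b y - (1 : Matrix (Fin m) (Fin m) ℝ) a b|) 0 :=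
      (((hh a b).continuousAt (hN.mem_nhds h0N)).sub continuousAt_const).abs
    refine h1.eventually_lt_const ?_
    simp only [h, hΨ0, hΨ00, ContinuousLinearEquiv.coe_coe, hLx, Matrix.one_apply, sub_self,
      abs_zero]
    positivity
  -- r₁ secures injectivity and positive definiteness, r₂ the identification of the curve with the
  -- v-axis.
  obtain ⟨r₁, hr₁, hball⟩ := Metric.mem_nhds_iff.1
    (inter_mem (e.open_source.mem_nhds h0e) hpd)
  obtain ⟨r₂, hr₂, hball₂⟩ := Metric.mem_nhds_iff.1 hcurve
  let e' := e.restrOpen (Metric.ball 0 (min r₁ r₂)) Metric.isOpen_ball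
  have hsub₁ : Metric.ball (0 : EuclideanSpace ℝ (Fin (m + 2))) (min r₁ r₂) ⊆
      Metric.ball 0 r₁ := Metric.ball_subset_ball (min_le_left _ _)
  have hsource : e'.source = Metric.ball 0 (min r₁ r₂) :=
    inter_eq_right.2 fun y hy ↦ (hball (hsub₁ hy)).1
  have heN' : ∀ y ∈ e'.source, y ∈ N := fun y hy ↦ heN hy.1
  have he' : (e' : EuclideanSpace ℝ (Fin (m + 2)) → _) = Ψ := funext heΨ
  refine ⟨e', min r₁ r₂, lt_min hr₁ hr₂, hsource, ?_, ?_, ?_, ?_, ?_, ?_⟩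
  · intro y hy
    have h1 := e'.map_target hy
    rw [← e'.right_inv hy, he']
    exact hΨΩ (heN' _ h1)
  · rw [he']
    exact hΨ.mono heN'
  · exact hesymm.mono fun y hy ↦ hy.1
  -- B lowers ∂_vΨ = B⁻¹ϖ to ϖ, whose pullback is the constant covector l ∘ L = du.
  · intro y hy w
    rw [he', hΨv y (heN' y hy), hright _ (hΨΩ (heN' y hy)), hϖ y (heN' y hy), hLv]
  · intro y hy
    rw [he']
    refine Matrix.posDef_of_abs_sub_one_lt ?_ fun a b ↦ ?_
    · ext a b
      exact hsymm _ (hΨΩ (heN' y hy)) _ _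
    · exact (hball (hsub₁ (hsource ▸ hy))).2 a b
  · intro t ht
    rw [he']
    refine hball₂ (?_ : t ∈ Metric.ball 0 r₂)
    rw [hsource, mem_ball_zero_iff, norm_smul, PiLp.norm_single, norm_one,
      mul_one] at ht
    exact mem_ball_zero_iff.2 (ht.trans_le (min_le_right _ _))

end LocalNullCoordinates

/-! ### The metric in a chart as a smooth field of nondegenerate bilinear forms. -/

section ChartCalculus

variable {n : ℕ} {M : Type*} [TopologicalSpace M] [ChartedSpace (EuclideanSpace ℝ (Fin n)) M]
  {φ : OpenPartialHomeomorph M (EuclideanSpace ℝ (Fin n))}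

/-- The differential of `φ` at `p`, as an endomorphism of the model space. -/
def chartDeriv (φ : OpenPartialHomeomorph M (EuclideanSpace ℝ (Fin n))) (p : M) :
    EuclideanSpace ℝ (Fin n) →L[ℝ] EuclideanSpace ℝ (Fin n) := mfderiv (𝓡 n) (𝓡 n) φ p

/-- The differential of `φ.symm` at `y`, as an endomorphism of the model space. -/
def chartSymmDeriv (φ : OpenPartialHomeomorph M (EuclideanSpace ℝ (Fin n)))
    (y : EuclideanSpace ℝ (Fin n)) :
    EuclideanSpace ℝ (Fin n) →L[ℝ] EuclideanSpace ℝ (Fin n) := mfderiv (𝓡 n) (𝓡 n) φ.symm y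

lemma IsSmoothChart.mdifferentiable (hφ : IsSmoothChart φ) : φ.MDifferentiable (𝓡 n) (𝓡 n) :=
  ⟨(contMDiffOn_of_mem_maximalAtlas hφ).mdifferentiableOn (by simp),
    (contMDiffOn_symm_of_mem_maximalAtlas hφ).mdifferentiableOn (by simp)⟩

lemma IsSmoothChart.chartSymmDeriv_chartDeriv (hφ : IsSmoothChart φ) {p : M}
    (hp : p ∈ φ.source) (v) :
    chartSymmDeriv φ (φ p) (chartDeriv φ p v) = v :=
  DFunLike.congr_fun (hφ.mdifferentiable.symm_comp_deriv hp) v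

lemma IsSmoothChart.chartDeriv_chartSymmDeriv (hφ : IsSmoothChart φ) {p : M}
    (hp : p ∈ φ.source) (v) :
    chartDeriv φ p (chartSymmDeriv φ (φ p) v) = v := by
  have := DFunLike.congr_fun (hφ.mdifferentiable.comp_symm_deriv (φ.map_source hp)) v
  rw [φ.left_inv hp] at this
  exact this

lemma IsSmoothChart.inverse_mfderiv (hφ : IsSmoothChart φ) {p : M} (hp : p ∈ φ.source) :
    (mfderiv (𝓡 n) (𝓡 n) φ p).inverse = chartSymmDeriv φ (φ p) := by
  exact ContinuousLinearMap.inverse_eq (f := chartDeriv φ p)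
    (by ext1 v; exact hφ.chartDeriv_chartSymmDeriv hp v)
    (by ext1 v; exact hφ.chartSymmDeriv_chartDeriv hp v)

lemma IsSmoothChart.coordField_eq (hφ : IsSmoothChart φ) {p : M} (hp : p ∈ φ.source) (i : Fin n) :
    coordField φ i p = chartSymmDeriv φ (φ p) (EuclideanSpace.single i 1) := by
  have := hφ.inverse_mfderiv hp
  rw [coordField, this]
  rfl

variable [IsManifold (𝓡 n) ∞ M]

/-- The metric at `p`, as a bilinear form on the model space of the tangent space. -/
def LorentzianMetric.form (g : LorentzianMetric n M) (p : M) :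
    EuclideanSpace ℝ (Fin n) →L[ℝ] EuclideanSpace ℝ (Fin n) →L[ℝ] ℝ := g.inner p

/-- The metric in the chart `φ`, as a field of bilinear forms on coordinate space. -/
def LorentzianMetric.coordForm (g : LorentzianMetric n M)
    (φ : OpenPartialHomeomorph M (EuclideanSpace ℝ (Fin n))) (y : EuclideanSpace ℝ (Fin n)) :
    EuclideanSpace ℝ (Fin n) →L[ℝ] EuclideanSpace ℝ (Fin n) →L[ℝ] ℝ :=
  (g.form (φ.symm y)).bilinearComp (chartSymmDeriv φ y) (chartSymmDeriv φ y)

lemma LorentzianMetric.contDiffOn_coordForm (g : LorentzianMetric n M) (hφ : IsSmoothChart φ) :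
    ContDiffOn ℝ ∞ (g.coordForm φ) φ.target := by
  have hD : ∀ v : EuclideanSpace ℝ (Fin n), ContMDiffOn (𝓡 n) (𝓡 n).tangent ∞
      (fun y : EuclideanSpace ℝ (Fin n) ↦ (TotalSpace.mk' (EuclideanSpace ℝ (Fin n)) (φ.symm y)
        (chartSymmDeriv φ y v) : TangentBundle (𝓡 n) M)) φ.target := by
    intro v
    have h1 := (contMDiffOn_symm_of_mem_maximalAtlas hφ).contMDiffOn_tangentMapWithin
      (m := ∞) (by simp) φ.open_target.uniqueMDiffOn
    have h2 := (contMDiff_vectorSpace_iff_contDiff (𝕜 := ℝ) (E := EuclideanSpace ℝ (Fin n))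
      (n := ∞) (V := fun _ ↦ v)).2 contDiff_const
    have h3 := h1.comp h2.contMDiffOn (s := φ.target) (fun y hy ↦ hy)
    refine h3.congr fun y hy ↦ ?_
    simp only [Function.comp, tangentMapWithin]
    rw [mfderivWithin_of_isOpen φ.open_target hy]
    rfl
  have h2 : ∀ v w, ContDiffOn ℝ ∞ (fun y ↦ g.coordForm φ y v w) φ.target := by
    intro v w
    have h3 := (g.contMDiff.comp_contMDiffOn
      (contMDiffOn_symm_of_mem_maximalAtlas hφ)).clm_bundle_apply₂
      (F₃ := ℝ) (E₃ := Trivial M ℝ) (hD v) (hD w)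
    rw [← contMDiffOn_iff_contDiffOn]
    intro y hy
    have h4 := (h3 y hy)
    rw [contMDiffWithinAt_totalSpace] at h4
    exact h4.2
  -- In finite dimension, smoothness of a field of linear maps may be tested on constant vectors.
  refine contDiffOn_clm_apply.2 fun v ↦ contDiffOn_clm_apply.2 fun w ↦ h2 v w

lemma LorentzianMetric.gram_eq_coordForm (g : LorentzianMetric n M) (hφ : IsSmoothChart φ)
    {y : EuclideanSpace ℝ (Fin n)} (hy : y ∈ φ.target) (i j : Fin n) :
    g.gram φ y i j =
      g.coordForm φ y (EuclideanSpace.single i 1) (EuclideanSpace.single j 1) := by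
  have := hφ.coordField_eq (φ.map_target hy)
  rw [φ.right_inv hy] at this
  simp only [LorentzianMetric.gram, Matrix.of_apply, this]
  rfl

/-- Pairing v with a vector of an orthonormal basis returns its coordinate up to sign. -/
lemma LorentzianMetric.eq_zero_of_form_eq_zero (g : LorentzianMetric n M) (p : M)
    {v : EuclideanSpace ℝ (Fin n)}
    (h : ∀ w, g.form p v w = 0) : v = 0 := by
  obtain ⟨b, i₀, hb⟩ := g.signature p
  have : ∀ i, b.repr v i = 0 := by
    intro i
    have h1 : g.inner p v (b i) = 0 := h (b i)
    rw [← b.sum_repr v] at h1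
    simp only [map_sum, map_smul, sum_apply, smul_apply, hb, smul_eq_mul,
      mul_ite, mul_zero, mul_one, Finset.sum_ite_eq', Finset.mem_univ, if_true] at h1
    split_ifs at h1 with hi
    · linarith
    · exact h1
  exact b.repr.map_eq_zero_iff.1 (Finsupp.ext this)

lemma LorentzianMetric.coordForm_symm (g : LorentzianMetric n M)
    (y v w : EuclideanSpace ℝ (Fin n)) :
    g.coordForm φ y v w = g.coordForm φ y w v :=
  g.symm _ _ _

lemma LorentzianMetric.coordForm_chartDeriv (g : LorentzianMetric n M) (hφ : IsSmoothChart φ)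
    {p : M} (hp : p ∈ φ.source) (v w : EuclideanSpace ℝ (Fin n)) :
    g.coordForm φ (φ p) (chartDeriv φ p v) (chartDeriv φ p w) = g.form p v w := by
  show g.form (φ.symm (φ p)) (chartSymmDeriv φ (φ p) (chartDeriv φ p v))
    (chartSymmDeriv φ (φ p) (chartDeriv φ p w)) = _
  rw [φ.left_inv hp, hφ.chartSymmDeriv_chartDeriv hp, hφ.chartSymmDeriv_chartDeriv hp]

lemma LorentzianMetric.eq_zero_of_coordForm_eq_zero (g : LorentzianMetric n M)
    (hφ : IsSmoothChart φ) {y : EuclideanSpace ℝ (Fin n)} (hy : y ∈ φ.target)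
    {v : EuclideanSpace ℝ (Fin n)} (h : ∀ w, g.coordForm φ y v w = 0) : v = 0 := by
  have hp := φ.map_target hy
  have h1 : chartSymmDeriv φ y v = 0 := by
    refine g.eq_zero_of_form_eq_zero (φ.symm y) fun w ↦ ?_
    have h2 := h (chartDeriv φ (φ.symm y) w)
    rw [← hφ.chartSymmDeriv_chartDeriv hp w, φ.right_inv hy]
    exact h2
  have h3 := hφ.chartDeriv_chartSymmDeriv hp v
  rw [φ.right_inv hy, h1, map_zero] at h3
  exact h3.symm

lemma ContinuousLinearMap.isInvertible_of_nondegenerate {E : Type*} [NormedAddCommGroup E]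
    [NormedSpace ℝ E] [FiniteDimensional ℝ E] (B : E →L[ℝ] E →L[ℝ] ℝ)
    (hB : ∀ v, (∀ w, B v w = 0) → v = 0) : B.IsInvertible := by
  have hinj : Function.Injective B.toLinearMap :=
    (injective_iff_map_eq_zero B.toLinearMap).2 fun v hv ↦ hB v fun w ↦ DFunLike.congr_fun hv w
  have hrank : finrank ℝ E = finrank ℝ (E →L[ℝ] ℝ) := by
    rw [← (LinearMap.toContinuousLinearMap : (E →ₗ[ℝ] ℝ) ≃ₗ[ℝ] _).finrank_eq]
    exact (Subspace.dual_finrank_eq (K := ℝ) (V := E)).symm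
  exact ⟨(LinearEquiv.ofInjectiveOfFinrankEq B.toLinearMap hinj hrank).toContinuousLinearEquiv,
    by ext; rfl⟩

lemma LorentzianMetric.isInvertible_coordForm (g : LorentzianMetric n M)
    (hφ : IsSmoothChart φ) {y : EuclideanSpace ℝ (Fin n)} (hy : y ∈ φ.target) :
    (g.coordForm φ y).IsInvertible :=
  (g.coordForm φ y).isInvertible_of_nondegenerate fun _ h ↦ g.eq_zero_of_coordForm_eq_zero hφ hy h

lemma EuclideanSpace.clm_apply_eq_sum {F : Type*} [NormedAddCommGroup F] [NormedSpace ℝ F]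
    (f : EuclideanSpace ℝ (Fin n) →L[ℝ] F) (v : EuclideanSpace ℝ (Fin n)) :
    f v = ∑ i, v i • f (EuclideanSpace.single i 1) := by
  conv_lhs => rw [← (EuclideanSpace.basisFun (Fin n) ℝ).sum_repr v]
  simp

/-- A kernel vector of the Gram matrix would be orthogonal to everything. Invertibility lets the
inverse matrix in the Christoffel symbols be cancelled. -/
lemma LorentzianMetric.isUnit_det_gram (g : LorentzianMetric n M)
    (hφ : IsSmoothChart φ) {y : EuclideanSpace ℝ (Fin n)} (hy : y ∈ φ.target) :
    IsUnit (g.gram φ y).det := by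
  rw [isUnit_iff_ne_zero]
  intro h
  obtain ⟨c, hc, hc0⟩ := Matrix.exists_mulVec_eq_zero_iff.2 h
  refine hc ?_
  have h1 : (WithLp.toLp 2 c : EuclideanSpace ℝ (Fin n)) = 0 := by
    refine g.eq_zero_of_coordForm_eq_zero hφ hy fun w ↦ ?_
    rw [EuclideanSpace.clm_apply_eq_sum]
    refine Finset.sum_eq_zero fun i _ ↦ ?_
    have h2 := congrFun hc0 i
    simp only [Matrix.mulVec, dotProduct, g.gram_eq_coordForm hφ hy, Pi.zero_apply] at h2
    rw [g.coordForm_symm, EuclideanSpace.clm_apply_eq_sum]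
    refine smul_eq_zero_of_right _ (Eq.trans (Finset.sum_congr rfl fun j _ ↦ ?_) h2)
    exact mul_comm _ _
  funext i
  exact congrFun (congrArg WithLp.ofLp h1) i

end ChartCalculus

/-! ### From Christoffel symbols to the Euler-Lagrange equations. -/

section GeodesicEquation

open Filter Topology

variable {n : ℕ} {M : Type*} [TopologicalSpace M] [ChartedSpace (EuclideanSpace ℝ (Fin n)) M]
  [IsManifold (𝓡 n) ∞ M] {φ : OpenPartialHomeomorph M (EuclideanSpace ℝ (Fin n))}

lemma EuclideanSpace.clm_apply₂_eq_sum {F : Type*} [NormedAddCommGroup F] [NormedSpace ℝ F]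
    (f : EuclideanSpace ℝ (Fin n) →L[ℝ] EuclideanSpace ℝ (Fin n) →L[ℝ] F)
    (v w : EuclideanSpace ℝ (Fin n)) :
    f v w = ∑ i, ∑ j, (v i * w j) • f (EuclideanSpace.single i 1) (EuclideanSpace.single j 1) := by
  rw [EuclideanSpace.clm_apply_eq_sum f v, sum_apply]
  refine Finset.sum_congr rfl fun i _ ↦ ?_
  rw [smul_apply, EuclideanSpace.clm_apply_eq_sum _ w, Finset.smul_sum]
  exact Finset.sum_congr rfl fun j _ ↦ smul_smul _ _ _

lemma LorentzianMetric.partialDeriv_gram (g : LorentzianMetric n M) (hφ : IsSmoothChart φ)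
    {y : EuclideanSpace ℝ (Fin n)} (hy : y ∈ φ.target) (k i j : Fin n) :
    partialDeriv k (fun z ↦ g.gram φ z i j) y =
      fderiv ℝ (g.coordForm φ) y (EuclideanSpace.single k 1) (EuclideanSpace.single i 1)
        (EuclideanSpace.single j 1) := by
  have h1 : (fun z ↦ g.gram φ z i j) =ᶠ[𝓝 y] fun z ↦
      g.coordForm φ z (EuclideanSpace.single i 1) (EuclideanSpace.single j 1) := by
    filter_upwards [φ.open_target.mem_nhds hy] with z hz using g.gram_eq_coordForm hφ hz i j
  have h2 : HasFDerivAt (g.coordForm φ) (fderiv ℝ (g.coordForm φ) y) y :=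
    (((g.contDiffOn_coordForm hφ).contDiffAt (φ.open_target.mem_nhds hy)).differentiableAt
      (by simp)).hasFDerivAt
  have h3 : HasFDerivAt (fun z ↦ g.coordForm φ z (EuclideanSpace.single i 1)
      (EuclideanSpace.single j 1)) _ y :=
    (h2.clm_apply (hasFDerivAt_const _ y)).clm_apply (hasFDerivAt_const _ y)
  rw [partialDeriv, h1.fderiv_eq, h3.fderiv]
  simp

/-- The Christoffel symbols, contracted twice with a vector. -/
lemma LorentzianMetric.sum_christoffel (g : LorentzianMetric n M) (hφ : IsSmoothChart φ)
    {y : EuclideanSpace ℝ (Fin n)} (hy : y ∈ φ.target) (v : EuclideanSpace ℝ (Fin n)) (k : Fin n) :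
    ∑ i, ∑ j, g.christoffel φ k i j y * v i * v j =
      (g.gram φ y)⁻¹.mulVec (fun l ↦ fderiv ℝ (g.coordForm φ) y v v (EuclideanSpace.single l 1)
        - 1 / 2 * fderiv ℝ (g.coordForm φ) y (EuclideanSpace.single l 1) v v) k := by
  set T := fderiv ℝ (g.coordForm φ) y with hT
  have h1 : ∀ w, T v v w = ∑ i, ∑ j,
      (v i * v j) * T (EuclideanSpace.single i 1) (EuclideanSpace.single j 1) w := fun w ↦ by
    rw [EuclideanSpace.clm_apply₂_eq_sum T v v]
    simp only [sum_apply, smul_apply, smul_eq_mul]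
  -- The two positive terms of the Christoffel symbol differ by exchanging i and j, so they agree
  -- after contraction with v twice.
  have h1' : ∀ w, T v v w = ∑ i, ∑ j,
      (v i * v j) * T (EuclideanSpace.single j 1) (EuclideanSpace.single i 1) w := fun w ↦ by
    rw [h1, Finset.sum_comm]
    exact Finset.sum_congr rfl fun i _ ↦ Finset.sum_congr rfl fun j _ ↦ by rw [mul_comm (v j)]
  have h2 : ∀ u, T u v v = ∑ i, ∑ j,
      (v i * v j) * T u (EuclideanSpace.single i 1) (EuclideanSpace.single j 1) := fun u ↦
    EuclideanSpace.clm_apply₂_eq_sum (T u) v v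
  have h3 : ∀ l, T v v (EuclideanSpace.single l 1) - 1 / 2 * T (EuclideanSpace.single l 1) v v =
      ∑ i, ∑ j, 1 / 2 * ((v i * v j) *
        (T (EuclideanSpace.single i 1) (EuclideanSpace.single j 1) (EuclideanSpace.single l 1)
        + T (EuclideanSpace.single j 1) (EuclideanSpace.single i 1) (EuclideanSpace.single l 1)
        - T (EuclideanSpace.single l 1) (EuclideanSpace.single i 1)
          (EuclideanSpace.single j 1))) := by
    intro l
    simp only [mul_add, mul_sub, Finset.sum_add_distrib, Finset.sum_sub_distrib,
      ← Finset.mul_sum]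
    rw [← h1, ← h1', ← h2]
    ring
  simp only [Matrix.mulVec, dotProduct, h3, LorentzianMetric.christoffel,
    g.partialDeriv_gram hφ hy]
  simp only [Finset.mul_sum, Finset.sum_mul]
  conv_rhs => rw [Finset.sum_comm]
  refine Finset.sum_congr rfl fun i _ ↦ ?_
  conv_rhs => rw [Finset.sum_comm]
  refine Finset.sum_congr rfl fun j _ ↦ Finset.sum_congr rfl fun l _ ↦ ?_
  rw [← hT]
  ring

/-- The geodesic equation in the chart `φ`, in Lagrangian form. -/
lemma LorentzianMetric.IsGeodesicOn.hasDerivAt_momentum {g : LorentzianMetric n M} {γ : ℝ → M}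
    {D : Set ℝ} (hγ : g.IsGeodesicOn γ D) (hφ : IsSmoothChart φ) {t : ℝ} (ht : t ∈ D)
    (htφ : γ t ∈ φ.source) :
    HasDerivAt (fun s ↦ φ (γ s)) (deriv (fun s ↦ φ (γ s)) t) t ∧
    ∃ p' : EuclideanSpace ℝ (Fin n) →L[ℝ] ℝ,
      HasDerivAt (fun s ↦ g.coordForm φ (φ (γ s)) (deriv (fun s ↦ φ (γ s)) s)) p' t ∧
        ∀ w, p' w = 1 / 2 * fderiv ℝ (g.coordForm φ) (φ (γ t)) w (deriv (fun s ↦ φ (γ s)) t)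
          (deriv (fun s ↦ φ (γ s)) t) := by
  have hopen : IsOpen (D ∩ γ ⁻¹' φ.source) :=
    hγ.contMDiffOn.continuousOn.isOpen_inter_preimage hγ.isOpen φ.open_source
  have hx : ContDiffOn ℝ ∞ (fun s ↦ φ (γ s)) (D ∩ γ ⁻¹' φ.source) := by
    rw [← contMDiffOn_iff_contDiffOn]
    exact (contMDiffOn_of_mem_maximalAtlas hφ).comp (hγ.contMDiffOn.mono inter_subset_left)
      fun s hs ↦ hs.2
  have hv : ContDiffOn ℝ ∞ (deriv fun s ↦ φ (γ s)) (D ∩ γ ⁻¹' φ.source) :=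
    hx.deriv_of_isOpen hopen (by simp)
  have hxd : ∀ s ∈ D ∩ γ ⁻¹' φ.source,
      HasDerivAt (fun s ↦ φ (γ s)) (deriv (fun s ↦ φ (γ s)) s) s := fun s hs ↦
    ((hx.contDiffAt (hopen.mem_nhds hs)).differentiableAt (by simp)).hasDerivAt
  have hvd : ∀ s ∈ D ∩ γ ⁻¹' φ.source, HasDerivAt (deriv fun s ↦ φ (γ s))
      (deriv (deriv fun s ↦ φ (γ s)) s) s := fun s hs ↦
    ((hv.contDiffAt (hopen.mem_nhds hs)).differentiableAt (by simp)).hasDerivAt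
  have hcomp : ∀ (f : ℝ → EuclideanSpace ℝ (Fin n)) (f' : EuclideanSpace ℝ (Fin n)) (s : ℝ)
      (k : Fin n), HasDerivAt f f' s → HasDerivAt (fun s ↦ f s k) (f' k) s := fun f f' s k h ↦
    (EuclideanSpace.proj (𝕜 := ℝ) k).hasFDerivAt.comp_hasDerivAt s h
  have hmem : t ∈ D ∩ γ ⁻¹' φ.source := ⟨ht, htφ⟩
  refine ⟨hxd t hmem, ?_⟩
  set x : ℝ → EuclideanSpace ℝ (Fin n) := fun s ↦ φ (γ s) with hxdef
  have hy : x t ∈ φ.target := φ.map_source htφ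
  have hB : HasFDerivAt (g.coordForm φ) (fderiv ℝ (g.coordForm φ) (x t)) (x t) :=
    (((g.contDiffOn_coordForm hφ).contDiffAt (φ.open_target.mem_nhds hy)).differentiableAt
      (by simp)).hasFDerivAt
  have hBx := hB.comp_hasDerivAt t (hxd t hmem)
  refine ⟨_, hBx.clm_apply (hvd t hmem), ?_⟩
  have hacc : ∀ k, deriv (deriv x) t k = -(g.gram φ (x t))⁻¹.mulVec
      (fun l ↦ fderiv ℝ (g.coordForm φ) (x t) (deriv x t) (deriv x t) (EuclideanSpace.single l 1)
        - 1 / 2 * fderiv ℝ (g.coordForm φ) (x t) (EuclideanSpace.single l 1)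
          (deriv x t) (deriv x t)) k := by
    intro k
    have h1 := hγ.eq φ hφ t ht htφ k
    have h2 : (deriv fun s ↦ φ (γ s) k) =ᶠ[𝓝 t] fun s ↦ deriv x s k := by
      filter_upwards [hopen.mem_nhds hmem] with s hs using (hcomp x _ s k (hxd s hs)).deriv
    have h3 : ∀ k, deriv (fun s ↦ φ (γ s) k) t = deriv x t k := fun k ↦
      (hcomp x _ t k (hxd t hmem)).deriv
    rw [LorentzianMetric.covDerivAlong, h2.deriv_eq, (hcomp _ _ t k (hvd t hmem)).deriv] at h1
    simp only [h3] at h1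
    rw [← g.sum_christoffel hφ hy]
    exact eq_neg_of_add_eq_zero_left h1
  set c : Fin n → ℝ := fun l ↦
    fderiv ℝ (g.coordForm φ) (x t) (deriv x t) (deriv x t) (EuclideanSpace.single l 1)
        - 1 / 2 * fderiv ℝ (g.coordForm φ) (x t) (EuclideanSpace.single l 1)
          (deriv x t) (deriv x t) with hc
  -- Lowering the acceleration with the metric cancels the inverse Gram matrix. Adding DB(ẋ)(ẋ, ·),
  -- the other term in the derivative of B(ẋ), then leaves only ½ DB(·)(ẋ, ẋ).
  have hlow : ∀ l, g.coordForm φ (x t) (deriv (deriv x) t) (EuclideanSpace.single l 1) = -c l := by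
    intro l
    have h1 : (g.gram φ (x t)).mulVec ((g.gram φ (x t))⁻¹.mulVec c) l = c l := by
      rw [Matrix.mulVec_mulVec, Matrix.mul_nonsing_inv _ (g.isUnit_det_gram hφ hy),
        Matrix.one_mulVec]
    rw [g.coordForm_symm, EuclideanSpace.clm_apply_eq_sum, ← h1]
    simp only [hacc, Matrix.mulVec, dotProduct, g.gram_eq_coordForm hφ hy, smul_eq_mul]
    rw [← Finset.sum_neg_distrib]
    exact Finset.sum_congr rfl fun j _ ↦ by ring
  intro w
  have h1 : ∀ p q : EuclideanSpace ℝ (Fin n) →L[ℝ] ℝ,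
      (∀ l, p (EuclideanSpace.single l 1) = q (EuclideanSpace.single l 1)) → p = q := fun p q h ↦ by
    ext u
    rw [EuclideanSpace.clm_apply_eq_sum p, EuclideanSpace.clm_apply_eq_sum q]
    simp only [h]
  let q : EuclideanSpace ℝ (Fin n) →L[ℝ] ℝ := (1 / 2 : ℝ) •
    (ContinuousLinearMap.apply ℝ ℝ (deriv x t) ∘L
      ContinuousLinearMap.apply ℝ _ (deriv x t) ∘L fderiv ℝ (g.coordForm φ) (x t))
  refine DFunLike.congr_fun (h1 _ q fun l ↦ ?_) w
  simp only [add_apply, Function.comp_apply, hlow, hc, q, smul_apply,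
    ContinuousLinearMap.comp_apply,
    ContinuousLinearMap.apply_apply, smul_eq_mul]
  ring

end GeodesicEquation

/-! ### Linear algebra of a null vector in a Lorentzian space. -/

section AdaptedFrame

variable {m : ℕ}

/-- In a Lorentzian vector space, a nonzero null vector `k` is part of a frame `(l, k, e₁, …, eₘ)`
with `β(k, l) = 1`, `e` orthonormal and orthogonal to `k`. -/
lemma exists_null_frame {E : Type*} [NormedAddCommGroup E] [NormedSpace ℝ E]
    (β : E →L[ℝ] E →L[ℝ] ℝ) (b : Basis (Fin (m + 2)) ℝ E) (i₀ : Fin (m + 2))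
    (hb : ∀ i j, β (b i) (b j) = if i = j then (if i = i₀ then -1 else 1) else 0)
    {k : E} (hk0 : k ≠ 0) (hk : β k k = 0) :
    ∃ (l : E) (e : Fin m → E), β k l = 1 ∧ (∀ a, β k (e a) = 0) ∧
      ∀ a c, β (e a) (e c) = if a = c then 1 else 0 := by
  let T : EuclideanSpace ℝ (Fin (m + 2)) → E := fun x ↦ ∑ i, x i • b i
  -- In coordinates the Lorentzian form is the Euclidean one with one sign flipped, so Euclidean
  -- orthogonal complements become available.
  have hT : ∀ x y, β (T x) (T y) = inner ℝ x y - 2 * (x i₀ * y i₀) := by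
    intro x y
    have h1 : ∀ j, β (T x) (b j) = (if j = i₀ then -1 else 1) * x j := fun j ↦ by
      simp only [T, map_sum, map_smul, sum_apply, smul_apply, hb, smul_eq_mul, mul_ite, mul_zero,
        Finset.sum_ite_eq', Finset.mem_univ, if_true]
      split_ifs <;> ring
    have h2 : ∀ j, y j * ((if j = i₀ then -1 else 1) * x j) =
        x j * y j - if j = i₀ then 2 * (x j * y j) else 0 := fun j ↦ by
      split_ifs <;> ring
    have h3 : inner ℝ x y = ∑ j, x j * y j := by
      simp [PiLp.inner_apply, mul_comm]
    have h4 : β (T x) (T y) = ∑ j, y j * β (T x) (b j) := by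
      show β (T x) (∑ j, y j • b j) = _
      simp only [map_sum, map_smul, smul_eq_mul]
    rw [h4]
    simp only [h1, h2]
    rw [Finset.sum_sub_distrib, Finset.sum_ite_eq', if_pos (Finset.mem_univ _), h3]
  let c : EuclideanSpace ℝ (Fin (m + 2)) := WithLp.toLp 2 (b.repr k)
  have hTc : T c = k := b.sum_repr k
  let d : EuclideanSpace ℝ (Fin (m + 2)) := EuclideanSpace.single i₀ 1
  have hd : ∀ x : EuclideanSpace ℝ (Fin (m + 2)), inner ℝ d x = x i₀ := fun x ↦ by
    simp [d, PiLp.inner_apply]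
  have hc0 : c i₀ ≠ 0 := by
    intro h
    rw [← hTc, hT, h] at hk
    have h1 : c = 0 := by simpa using hk
    exact hk0 (by rw [← hTc, h1]; simp [T])
  -- Vectors Euclidean-orthogonal to the time axis d have no time component, so on them the two
  -- forms agree; orthogonality to c then gives orthogonality to k. Only dim U ≤ 2 is needed to find
  -- m of them.
  let U : Submodule ℝ (EuclideanSpace ℝ (Fin (m + 2))) := Submodule.span ℝ {d, c}
  have hU : finrank ℝ U ≤ 2 := by
    have := finrank_span_finset_le_card (R := ℝ) ({d, c} : Finset (EuclideanSpace ℝ (Fin (m + 2))))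
    rw [Finset.coe_pair] at this
    exact this.trans Finset.card_le_two
  have hUm : m ≤ finrank ℝ Uᗮ := by
    have h1 := U.finrank_add_finrank_orthogonal
    rw [finrank_euclideanSpace_fin] at h1
    omega
  let u : Fin m → EuclideanSpace ℝ (Fin (m + 2)) := fun a ↦
    (stdOrthonormalBasis ℝ Uᗮ (Fin.castLE hUm a) : Uᗮ)
  have hu : ∀ a a', inner ℝ (u a) (u a') = if a = a' then (1 : ℝ) else 0 := by
    intro a a'
    have := orthonormal_iff_ite.1 (stdOrthonormalBasis ℝ Uᗮ).orthonormal (Fin.castLE hUm a)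
      (Fin.castLE hUm a')
    refine Eq.trans this ?_
    simp only [(Fin.castLE_injective hUm).eq_iff]
  have hud : ∀ a, u a i₀ = 0 := fun a ↦ by
    rw [← hd]
    exact Submodule.inner_right_of_mem_orthogonal (Submodule.subset_span (by simp))
      (stdOrthonormalBasis ℝ Uᗮ (Fin.castLE hUm a)).2
  have huc : ∀ a, inner ℝ c (u a) = 0 := fun a ↦
    Submodule.inner_right_of_mem_orthogonal (Submodule.subset_span (by simp))
      (stdOrthonormalBasis ℝ Uᗮ (Fin.castLE hUm a)).2
  -- k pairs with the timelike basis vector to -c i₀, which fixes the scale of l. This l is not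
  -- null, which is harmless because the du² coefficient is free.
  refine ⟨T (-(c i₀)⁻¹ • d), fun a ↦ T (u a), ?_, fun a ↦ ?_, fun a a' ↦ ?_⟩
  · rw [← hTc, hT, inner_smul_right, real_inner_comm, hd]
    simp [d]
    field_simp
    ring
  · rw [← hTc, hT, huc, hud]; simp
  · rw [hT, hu, hud]; simp

end AdaptedFrame

/-! ### Recognizing null coordinate charts and changing coordinates. -/

section NullCharts

open Filter Topology

variable {m : ℕ}

/-- A linear change of coordinates adapted to a null frame. -/
lemma exists_null_frame_equiv
    (β : EuclideanSpace ℝ (Fin (m + 2)) →L[ℝ] EuclideanSpace ℝ (Fin (m + 2)) →L[ℝ] ℝ)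
    (hβ : ∀ v w, β v w = β w v) {k l : EuclideanSpace ℝ (Fin (m + 2))} (hk0 : k ≠ 0)
    (hk : β k k = 0) {e : Fin m → EuclideanSpace ℝ (Fin (m + 2))} (hl : β k l = 1)
    (he : ∀ a, β k (e a) = 0) (hee : ∀ a c, β (e a) (e c) = if a = c then 1 else 0) :
    ∃ L : EuclideanSpace ℝ (Fin (m + 2)) ≃L[ℝ] EuclideanSpace ℝ (Fin (m + 2)),
      L (EuclideanSpace.single 1 1) = k ∧ (∀ w, β k (L w) = w 0) ∧
      ∀ a c, β (L (EuclideanSpace.single (xIdx a) 1)) (L (EuclideanSpace.single (xIdx c) 1)) =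
        if a = c then 1 else 0 := by
  let Λ : EuclideanSpace ℝ (Fin (m + 2)) →L[ℝ] EuclideanSpace ℝ (Fin (m + 2)) :=
    (EuclideanSpace.proj (𝕜 := ℝ) (0 : Fin (m + 2))).smulRight l +
      (EuclideanSpace.proj (𝕜 := ℝ) (1 : Fin (m + 2))).smulRight k +
      ∑ a, (EuclideanSpace.proj (𝕜 := ℝ) (xIdx a)).smulRight (e a)
  have hΛ : ∀ w, Λ w = w 0 • l + w 1 • k + ∑ a, w (xIdx a) • e a := fun w ↦ by
    simp [Λ, sum_apply]
  have h0 : ∀ w, β k (Λ w) = w 0 := fun w ↦ by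
    simp [hΛ, hl, hk, he]
  -- Pairing with k isolates the u-component, pairing with the e a then isolates the x-components,
  -- and k ≠ 0 disposes of the last one.
  have hinj : Function.Injective Λ.toLinearMap := by
    refine (injective_iff_map_eq_zero Λ.toLinearMap).2 fun w hw ↦ ?_
    have hw' : Λ w = 0 := hw
    have hw0 : w 0 = 0 := by rw [← h0, hw', map_zero]
    have hwx : ∀ a, w (xIdx a) = 0 := fun a ↦ by
      have h1 : β (e a) (Λ w) = w (xIdx a) := by
        simp [hΛ, hw0, hβ (e a) k, he, hee]
      rw [← h1, hw', map_zero]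
    have hw1 : w 1 = 0 := by
      rw [hΛ, hw0] at hw'
      simpa [hwx, hk0] using hw'
    ext i
    refine Fin.cases hw0 (fun i ↦ Fin.cases hw1 (fun a ↦ hwx a) i) i
  have hx0 : ∀ a : Fin m, xIdx a ≠ 0 := fun a ↦ Fin.succ_ne_zero _
  have hx1 : ∀ a : Fin m, xIdx a ≠ 1 := fun a h ↦ Fin.succ_ne_zero a (Fin.succ_injective _ h)
  have hxx : ∀ a c : Fin m, xIdx a = xIdx c ↔ a = c := fun a c ↦
    ⟨fun h ↦ Fin.succ_injective _ (Fin.succ_injective _ h), fun h ↦ h ▸ rfl⟩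
  have hΛx : ∀ a, Λ (EuclideanSpace.single (xIdx a) 1) = e a := fun a ↦ by
    simp [hΛ, (hx0 a).symm, (hx1 a).symm, hxx]
  refine ⟨(LinearEquiv.ofInjectiveEndo Λ.toLinearMap hinj).toContinuousLinearEquiv, ?_,
    fun w ↦ h0 w, fun a c ↦ ?_⟩
  · show Λ _ = k
    simp [hΛ, hx1]
  · show β (Λ _) (Λ _) = _
    rw [hΛx, hΛx, hee]

/-- The decomposition of a symmetric bilinear form in null coordinates. -/
lemma null_form_eq_sum
    (β : EuclideanSpace ℝ (Fin (m + 2)) →L[ℝ] EuclideanSpace ℝ (Fin (m + 2)) →L[ℝ] ℝ)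
    (hβ : ∀ v w, β v w = β w v) (h1 : ∀ w, β (EuclideanSpace.single 1 1) w = w 0)
    (v w : EuclideanSpace ℝ (Fin (m + 2))) :
    β v w = (v 0 * w 1 + v 1 * w 0) +
      β (EuclideanSpace.single 0 1) (EuclideanSpace.single 0 1) * v 0 * w 0 +
      ∑ a, β (EuclideanSpace.single (xIdx a) 1) (EuclideanSpace.single 0 1) *
        (v (xIdx a) * w 0 + v 0 * w (xIdx a)) +
      ∑ a, ∑ c, β (EuclideanSpace.single (xIdx a) 1) (EuclideanSpace.single (xIdx c) 1) *
        v (xIdx a) * w (xIdx c) := by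
  have hx0 : ∀ a : Fin m, xIdx a ≠ 0 := fun a ↦ Fin.succ_ne_zero _
  have hs : ∀ (f : EuclideanSpace ℝ (Fin (m + 2)) →L[ℝ] ℝ) (u : EuclideanSpace ℝ (Fin (m + 2))),
      f u = u 0 * f (EuclideanSpace.single 0 1) + u 1 * f (EuclideanSpace.single 1 1) +
        ∑ a, u (xIdx a) * f (EuclideanSpace.single (xIdx a) 1) := fun f u ↦ by
    rw [EuclideanSpace.clm_apply_eq_sum, Fin.sum_univ_succ, Fin.sum_univ_succ, ← add_assoc]
    rfl
  have h01 : β (EuclideanSpace.single 0 1) (EuclideanSpace.single 1 1) = 1 := by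
    rw [hβ, h1]; simp
  have hx1 : ∀ a, β (EuclideanSpace.single (xIdx a) 1) (EuclideanSpace.single 1 1) = 0 :=
    fun a ↦ by rw [hβ, h1]; simp [(hx0 a).symm]
  have hv : ∀ u, β v u = v 0 * β (EuclideanSpace.single 0 1) u + v 1 * u 0 +
      ∑ a, v (xIdx a) * β (EuclideanSpace.single (xIdx a) 1) u := fun u ↦ by
    rw [hβ, hs (β u) v, hβ u, hβ u, h1]
    simp only [hβ u]
  rw [hv, hs (β (EuclideanSpace.single 0 1)) w, h01]
  have h2 : ∀ a, β (EuclideanSpace.single (xIdx a) 1) w =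
      w 0 * β (EuclideanSpace.single (xIdx a) 1) (EuclideanSpace.single 0 1) +
        ∑ c, w (xIdx c) * β (EuclideanSpace.single (xIdx a) 1)
          (EuclideanSpace.single (xIdx c) 1) := fun a ↦ by
    rw [hs (β (EuclideanSpace.single (xIdx a) 1)) w, hx1]; ring
  simp only [h2, mul_add, Finset.mul_sum, Finset.sum_add_distrib, hβ (EuclideanSpace.single 0 1)
    (EuclideanSpace.single (xIdx _) 1)]
  have h3 : ∀ a, v 0 * (w (xIdx a) * β (EuclideanSpace.single (xIdx a) 1)
      (EuclideanSpace.single 0 1)) = β (EuclideanSpace.single (xIdx a) 1)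
      (EuclideanSpace.single 0 1) * (v 0 * w (xIdx a)) := fun a ↦ by ring
  have h4 : ∀ a, v (xIdx a) * (w 0 * β (EuclideanSpace.single (xIdx a) 1)
      (EuclideanSpace.single 0 1)) = β (EuclideanSpace.single (xIdx a) 1)
      (EuclideanSpace.single 0 1) * (v (xIdx a) * w 0) := fun a ↦ by ring
  have h5 : ∀ a c, v (xIdx a) * (w (xIdx c) * β (EuclideanSpace.single (xIdx a) 1)
      (EuclideanSpace.single (xIdx c) 1)) = β (EuclideanSpace.single (xIdx a) 1)
      (EuclideanSpace.single (xIdx c) 1) * v (xIdx a) * w (xIdx c) := fun a c ↦ by ring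
  simp only [h3, h4, h5]
  ring

variable {M : Type*} [TopologicalSpace M]
  [ChartedSpace (EuclideanSpace ℝ (Fin (m + 2))) M] [IsManifold (𝓡 (m + 2)) ∞ M]

/-- A chart in which `∂_v` is null, orthogonal to every `∂/∂xᵃ`, and of product one with `∂_u`. -/
lemma LorentzianMetric.isNullCoordinateChart_of_coordForm (g : LorentzianMetric (m + 2) M)
    {ψ : OpenPartialHomeomorph M (EuclideanSpace ℝ (Fin (m + 2)))} (hψ : IsSmoothChart ψ)
    (h1 : ∀ y ∈ ψ.target, ∀ w, g.coordForm ψ y (EuclideanSpace.single 1 1) w = w 0)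
    (hpos : ∀ y ∈ ψ.target, (Matrix.of fun a b : Fin m ↦ g.coordForm ψ y
      (EuclideanSpace.single (xIdx a) 1) (EuclideanSpace.single (xIdx b) 1)).PosDef) :
    g.IsNullCoordinateChart ψ := by
  have hsm : ∀ v w, ContDiffOn ℝ ∞ (fun y ↦ g.coordForm ψ y v w) ψ.target := fun v w ↦
    ((g.contDiffOn_coordForm hψ).clm_apply contDiffOn_const).clm_apply contDiffOn_const
  refine ⟨hψ, fun y ↦ g.coordForm ψ y (EuclideanSpace.single 0 1) (EuclideanSpace.single 0 1),
    fun a y ↦ g.coordForm ψ y (EuclideanSpace.single (xIdx a) 1) (EuclideanSpace.single 0 1),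
    fun y ↦ Matrix.of fun a b ↦ g.coordForm ψ y (EuclideanSpace.single (xIdx a) 1)
      (EuclideanSpace.single (xIdx b) 1),
    hsm _ _, fun a ↦ hsm _ _, fun a b ↦ hsm _ _, hpos, fun p hp X Y ↦ ?_⟩
  have h2 := null_form_eq_sum (g.coordForm ψ (ψ p)) (g.coordForm_symm (ψ p))
    (h1 _ (ψ.map_source hp)) (chartDeriv ψ p X) (chartDeriv ψ p Y)
  exact (g.coordForm_chartDeriv hψ hp X Y).symm.trans h2

lemma IsSmoothChart.trans_symm {n : ℕ} {M : Type*} [TopologicalSpace M]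
    [ChartedSpace (EuclideanSpace ℝ (Fin n)) M] [IsManifold (𝓡 n) ∞ M]
    {φ : OpenPartialHomeomorph M (EuclideanSpace ℝ (Fin n))} (hφ : IsSmoothChart φ)
    {e : OpenPartialHomeomorph (EuclideanSpace ℝ (Fin n)) (EuclideanSpace ℝ (Fin n))}
    (he : ContDiffOn ℝ ∞ e e.source) (he' : ContDiffOn ℝ ∞ e.symm e.target) :
    IsSmoothChart (φ.trans e.symm) := by
  refine OpenPartialHomeomorph.mem_maximalAtlas_of_contMDiffOn _ ?_ ?_
  · exact he'.contMDiffOn.comp ((contMDiffOn_of_mem_maximalAtlas hφ).mono fun p hp ↦ hp.1)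
      fun p hp ↦ hp.2
  · exact (contMDiffOn_symm_of_mem_maximalAtlas hφ).comp
      (he.contMDiffOn.mono fun y hy ↦ hy.1) fun y hy ↦ hy.2

lemma LorentzianMetric.coordForm_trans_symm {n : ℕ} {M : Type*} [TopologicalSpace M]
    [ChartedSpace (EuclideanSpace ℝ (Fin n)) M] [IsManifold (𝓡 n) ∞ M] (g : LorentzianMetric n M)
    {φ : OpenPartialHomeomorph M (EuclideanSpace ℝ (Fin n))} (hφ : IsSmoothChart φ)
    {e : OpenPartialHomeomorph (EuclideanSpace ℝ (Fin n)) (EuclideanSpace ℝ (Fin n))}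
    (he : ContDiffOn ℝ ∞ e e.source) {y : EuclideanSpace ℝ (Fin n)} (hy : y ∈ e.source)
    (hey : e y ∈ φ.target) (v w : EuclideanSpace ℝ (Fin n)) :
    g.coordForm (φ.trans e.symm) y v w =
      g.coordForm φ (e y) (fderiv ℝ e y v) (fderiv ℝ e y w) := by
  have h1 : ∀ u, chartSymmDeriv (φ.trans e.symm) y u =
      chartSymmDeriv φ (e y) (fderiv ℝ e y u) := fun u ↦ by
    have h2 : DifferentiableAt ℝ e y :=
      (he.contDiffAt (e.open_source.mem_nhds hy)).differentiableAt (by simp)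
    have h3 := mfderiv_comp (I := 𝓡 n) (I' := 𝓡 n) (I'' := 𝓡 n) y
      (hφ.mdifferentiable.mdifferentiableAt_symm hey) h2.mdifferentiableAt
    have h4 := DFunLike.congr_fun h3 u
    rw [mfderiv_eq_fderiv] at h4
    exact h4
  show g.form (φ.symm (e y)) (chartSymmDeriv (φ.trans e.symm) y v)
    (chartSymmDeriv (φ.trans e.symm) y w) = _
  rw [h1, h1]
  rfl

end NullCharts

/-! ### Coordinate lines and integral curves. -/

section IntegralCurve

open Filter Topology

variable {n : ℕ} {M : Type*} [TopologicalSpace M] [ChartedSpace (EuclideanSpace ℝ (Fin n)) M]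

/-- A curve that follows a coordinate line near the centre of a ball-shaped chart does so as long as
it stays in the chart. -/
lemma eq_smul_single_of_image_uIcc_subset {F : Type*} [NormedAddCommGroup F] [NormedSpace ℝ F]
    {ψ : OpenPartialHomeomorph M F} {γ : ℝ → M}
    {D : Set ℝ} (hD : D.OrdConnected) (hγ : ContinuousOn γ D) {t₀ : ℝ} (ht₀ : t₀ ∈ D) {r : ℝ}
    {v : F} (hv : ‖v‖ = 1) (htarget : ψ.target = Metric.ball 0 r)
    (hline : ∀ t, ‖t - t₀‖ < r → γ t ∈ ψ.source → ψ (γ t) = (t - t₀) • v)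
    {t : ℝ} (ht : t ∈ D) (hts : γ '' uIcc t₀ t ⊆ ψ.source) : ψ (γ t) = (t - t₀) • v := by
  have hmem : γ t ∈ ψ.source := hts (mem_image_of_mem γ right_mem_uIcc)
  by_cases hlt : ‖t - t₀‖ < r
  · exact hline t hlt hmem
  exfalso
  rw [not_lt] at hlt
  have hr : 0 < r := by
    have h1 := ψ.map_source hmem
    rw [htarget] at h1
    exact Metric.pos_of_mem_ball h1
  have hpos : 0 < ‖t - t₀‖ := hr.trans_le hlt
  -- On the segment from t₀ to t, rescaled to [0, 1], c marks the parameter at distance exactly r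
  -- from t₀.
  set c := r / ‖t - t₀‖ with hc
  have hc0 : 0 < c := div_pos hr hpos
  have hc1 : c ≤ 1 := (div_le_one hpos).2 hlt
  let τ : ℝ → ℝ := fun s ↦ t₀ + s * (t - t₀)
  have hτ : ∀ s ∈ Icc (0 : ℝ) c, τ s ∈ uIcc t₀ t := by
    intro s hs
    have h1 : τ s = AffineMap.lineMap t₀ t s := by simp [τ, AffineMap.lineMap_apply]; ring
    rw [← segment_eq_uIcc, segment_eq_image_lineMap, h1]
    exact mem_image_of_mem _ ⟨hs.1, hs.2.trans hc1⟩
  have hτs : MapsTo (fun s ↦ γ (τ s)) (Icc 0 c) ψ.source := fun s hs ↦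
    hts (mem_image_of_mem γ (hτ s hs))
  have hcont : ContinuousOn (fun s ↦ ψ (γ (τ s))) (Icc 0 c) :=
    ψ.continuousOn.comp (hγ.comp (by fun_prop) fun s hs ↦ hD.uIcc_subset ht₀ ht (hτ s hs)) hτs
  have heq : EqOn (fun s ↦ ψ (γ (τ s))) (fun s ↦ (s * (t - t₀)) • v) (Ico 0 c) := by
    intro s hs
    have h1 : τ s - t₀ = s * (t - t₀) := by simp [τ]
    have h2 : ‖τ s - t₀‖ < r := by
      rw [h1, norm_mul, Real.norm_of_nonneg hs.1, ← lt_div_iff₀ hpos]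
      exact hs.2
    simp only
    rw [hline _ h2 (hτs (Ico_subset_Icc_self hs)), h1]
  have heq' : EqOn (fun s ↦ ψ (γ (τ s))) (fun s ↦ (s * (t - t₀)) • v) (Icc 0 c) :=
    heq.of_subset_closure hcont (by fun_prop) Ico_subset_Icc_self
      (by rw [closure_Ico hc0.ne])
  -- By continuity the linear formula persists at s = c, where its value has norm r and so lies
  -- outside the open ball that is the chart's image.
  have hend := heq' (right_mem_Icc.2 hc0.le)
  have h1 := ψ.map_source (hτs (right_mem_Icc.2 hc0.le))
  simp only at hend
  rw [hend, htarget, mem_ball_zero_iff, norm_smul, hv, mul_one, norm_mul,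
    Real.norm_of_nonneg hc0.le, hc, div_mul_cancel₀ _ hpos.ne'] at h1
  exact lt_irrefl _ h1

/-- A coordinate line, parametrized by the coordinate, is an integral curve of the coordinate
vector field. -/
lemma IsSmoothChart.isMIntegralCurveOn {ψ : OpenPartialHomeomorph M (EuclideanSpace ℝ (Fin n))}
    (hψ : IsSmoothChart ψ) {γ : ℝ → M} {s : Set ℝ} (hs : MapsTo γ s ψ.source) {t₀ : ℝ} {i : Fin n}
    (h : ∀ t ∈ s, ψ (γ t) = (t - t₀) • EuclideanSpace.single i (1 : ℝ)) :
    IsMIntegralCurveOn γ (fun p ↦ coordField ψ i p) s := by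
  have heq : ∀ t ∈ s, γ t = ψ.symm ((t - t₀) • EuclideanSpace.single i (1 : ℝ)) := fun t ht ↦ by
    rw [← h t ht, ψ.left_inv (hs ht)]
  intro t ht
  have hmem : (t - t₀) • EuclideanSpace.single i (1 : ℝ) ∈ ψ.target := by
    rw [← h t ht]; exact ψ.map_source (hs ht)
  have h1 : HasFDerivAt (fun t : ℝ ↦ (t - t₀) • EuclideanSpace.single i (1 : ℝ))
      ((1 : ℝ →L[ℝ] ℝ).smulRight (EuclideanSpace.single i (1 : ℝ))) t := by
    refine (((hasDerivAt_id t).sub_const t₀).smul_const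
      (EuclideanSpace.single i (1 : ℝ))).hasFDerivAt.congr_fderiv ?_
    ext1
    simp
  have h2 := ((hψ.mdifferentiable.mdifferentiableAt_symm hmem).hasMFDerivAt.comp t
    h1.hasMFDerivAt).hasMFDerivWithinAt (s := s)
  have h3 := h2.congr_of_eventuallyEq (f₁ := γ)
    (by filter_upwards [self_mem_nhdsWithin] with u hu using heq u hu) (heq t ht)
  have h4 := hψ.coordField_eq (hs ht) i
  rw [h t ht] at h4
  have h5 : (chartSymmDeriv ψ ((t - t₀) • EuclideanSpace.single i (1 : ℝ))).comp
      ((1 : ℝ →L[ℝ] ℝ).smulRight (EuclideanSpace.single i (1 : ℝ))) =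
      (1 : ℝ →L[ℝ] ℝ).smulRight (show EuclideanSpace ℝ (Fin n) from coordField ψ i (γ t)) := by
    ext1
    rw [ContinuousLinearMap.comp_apply, ContinuousLinearMap.smulRight_apply,
      one_apply_eq_self, one_smul]
    exact h4.symm.trans
      (one_smul ℝ (show EuclideanSpace ℝ (Fin n) from coordField ψ i (γ t))).symm
  exact (congrArg (HasMFDerivWithinAt 𝓘(ℝ, ℝ) (𝓡 n) γ s t) h5).mp h3

end IntegralCurve

/-! ### Null coordinate charts along a null geodesic. -/

section NullGeodesicCharts

open Filter Topology

lemma chartDeriv_velocity {n : ℕ} {M : Type*} [TopologicalSpace M]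
    [ChartedSpace (EuclideanSpace ℝ (Fin n)) M]
    {φ : OpenPartialHomeomorph M (EuclideanSpace ℝ (Fin n))} (hφ : IsSmoothChart φ) {γ : ℝ → M}
    {t : ℝ} (hγ : MDifferentiableAt 𝓘(ℝ, ℝ) (𝓡 n) γ t) (ht : γ t ∈ φ.source) :
    chartDeriv φ (γ t) (velocity γ t) = deriv (fun s ↦ φ (γ s)) t := by
  have h1 := mfderiv_comp (I := 𝓘(ℝ, ℝ)) (I' := 𝓡 n) (I'' := 𝓡 n) t
    (hφ.mdifferentiable.mdifferentiableAt ht) hγ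
  rw [mfderiv_eq_fderiv] at h1
  exact (DFunLike.congr_fun h1 (1 : ℝ)).symm.trans fderiv_apply_one_eq_deriv

variable {m : ℕ} {M : Type*} [TopologicalSpace M]
  [ChartedSpace (EuclideanSpace ℝ (Fin (m + 2))) M] [IsManifold (𝓡 (m + 2)) ∞ M]

/-- A linear change of the coordinates `φ` adapted to a nonzero null tangent vector. -/
lemma LorentzianMetric.exists_null_frame_chart (g : LorentzianMetric (m + 2) M)
    {φ : OpenPartialHomeomorph M (EuclideanSpace ℝ (Fin (m + 2)))} (hφ : IsSmoothChart φ) {p : M}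
    (hp : p ∈ φ.source) {k : EuclideanSpace ℝ (Fin (m + 2))} (hk0 : k ≠ 0)
    (hk : g.form p k k = 0) :
    ∃ L : EuclideanSpace ℝ (Fin (m + 2)) ≃L[ℝ] EuclideanSpace ℝ (Fin (m + 2)),
      L (EuclideanSpace.single 1 1) = chartDeriv φ p k ∧
      (∀ w, g.coordForm φ (φ p) (chartDeriv φ p k) (L w) = w 0) ∧
      ∀ a c : Fin m, g.coordForm φ (φ p) (L (EuclideanSpace.single (xIdx a) 1))
        (L (EuclideanSpace.single (xIdx c) 1)) = if a = c then 1 else 0 := by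
  have hsig : ∃ (b : Basis (Fin (m + 2)) ℝ (EuclideanSpace ℝ (Fin (m + 2)))) (i₀ : Fin (m + 2)),
      ∀ i j, g.form p (b i) (b j) = if i = j then (if i = i₀ then -1 else 1) else 0 :=
    g.signature p
  obtain ⟨b, i₀, hb⟩ := hsig
  obtain ⟨l, e, hl, he, hee⟩ := exists_null_frame (g.form p) b i₀ hb hk0 hk
  have h := g.coordForm_chartDeriv hφ hp
  refine exists_null_frame_equiv (g.coordForm φ (φ p)) (g.coordForm_symm (φ p))
    (k := chartDeriv φ p k) (l := chartDeriv φ p l) (e := fun a ↦ chartDeriv φ p (e a))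
    (fun h0 ↦ hk0 ?_) (by rw [h, hk]) (by rw [h, hl]) (fun a ↦ by rw [h, he])
    (fun a c ↦ by rw [h, hee])
  rw [← hφ.chartSymmDeriv_chartDeriv hp k, h0, map_zero]

/-- Around each of its points, a null geodesic is a coordinate line of a chart of null coordinates
with values in a ball. -/
lemma LorentzianMetric.IsNullGeodesicOn.exists_isNullCoordinateChart
    {g : LorentzianMetric (m + 2) M} {γ : ℝ → M} {D : Set ℝ} (hγ : g.IsNullGeodesicOn γ D) {t₀ : ℝ}
    (ht₀ : t₀ ∈ D) :
    ∃ (ψ : OpenPartialHomeomorph M (EuclideanSpace ℝ (Fin (m + 2)))) (r : ℝ),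
      g.IsNullCoordinateChart ψ ∧ γ t₀ ∈ ψ.source ∧ ψ (γ t₀) = 0 ∧ ψ.target = Metric.ball 0 r ∧
      ∀ t, ‖t - t₀‖ < r → γ t ∈ ψ.source → ψ (γ t) = (t - t₀) • EuclideanSpace.single 1 1 := by
  let φ := chartAt (EuclideanSpace ℝ (Fin (m + 2))) (γ t₀)
  have hφ : IsSmoothChart φ := IsManifold.chart_mem_maximalAtlas (γ t₀)
  have hp : γ t₀ ∈ φ.source := mem_chart_source _ (γ t₀)
  have hopen : IsOpen (D ∩ γ ⁻¹' φ.source) :=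
    hγ.contMDiffOn.continuousOn.isOpen_inter_preimage hγ.isOpen φ.open_source
  have hnhds : ∀ᶠ t in 𝓝 t₀, t ∈ D ∩ γ ⁻¹' φ.source := hopen.mem_nhds ⟨ht₀, hp⟩
  have hvel : chartDeriv φ (γ t₀) (velocity γ t₀) = deriv (fun s ↦ φ (γ s)) t₀ :=
    chartDeriv_velocity hφ ((hγ.contMDiffOn.contMDiffAt (hγ.isOpen.mem_nhds ht₀)).mdifferentiableAt
      (by simp)) hp
  obtain ⟨L, hL, hLv, hLx⟩ := g.exists_null_frame_chart hφ hp (k := velocity γ t₀)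
    (hγ.velocity_ne_zero t₀ ht₀) (hγ.null t₀ ht₀)
  rw [hvel] at hL hLv
  obtain ⟨e, r, hr, hsource, htarget, he, he', h1, hpos, hline⟩ :=
    exists_null_coordinates_local φ.open_target (g.contDiffOn_coordForm hφ)
      (fun x hx ↦ g.isInvertible_coordForm hφ hx) (fun x _ ↦ g.coordForm_symm x)
      (x := fun s ↦ φ (γ s)) (t₀ := t₀) (φ.map_source hp)
      (hnhds.mono fun t ht ↦ (hγ.hasDerivAt_momentum hφ ht.1 ht.2).1)
      (hnhds.mono fun t ht ↦ (hγ.hasDerivAt_momentum hφ ht.1 ht.2).2) L hL hLv hLx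
  have hψ : IsSmoothChart (φ.trans e.symm) := hφ.trans_symm he he'
  have hψt : (φ.trans e.symm).target = e.source :=
    inter_eq_left.2 fun y hy ↦ htarget (e.map_source hy)
  have hcoord : ∀ y ∈ e.source, ∀ v w, g.coordForm (φ.trans e.symm) y v w =
      g.coordForm φ (e y) (fderiv ℝ e y v) (fderiv ℝ e y w) := fun y hy ↦
    g.coordForm_trans_symm hφ he hy (htarget (e.map_source hy))
  have h0 : (0 : EuclideanSpace ℝ (Fin (m + 2))) ∈ e.source := by
    rw [hsource]; exact Metric.mem_ball_self hr
  have he0 : e 0 = φ (γ t₀) := by simpa [h0] using hline 0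
  refine ⟨φ.trans e.symm, r, g.isNullCoordinateChart_of_coordForm hψ ?_ ?_, ?_, ?_, ?_, ?_⟩
  · intro y hy w
    rw [hψt] at hy
    rw [hcoord y hy, h1 y hy]
  · intro y hy
    rw [hψt] at hy
    simpa only [hcoord y hy] using hpos y hy
  · refine ⟨hp, ?_⟩
    show φ (γ t₀) ∈ e.target
    rw [← he0]
    exact e.map_source h0
  · show e.symm (φ (γ t₀)) = 0
    rw [← he0, e.left_inv h0]
  · rw [hψt, hsource]
  · intro t ht _
    have hmem : (t - t₀) • EuclideanSpace.single (1 : Fin (m + 2)) (1 : ℝ) ∈ e.source := by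
      rw [hsource, mem_ball_zero_iff, norm_smul, PiLp.norm_single]
      simpa using ht
    have h2 := hline (t - t₀) hmem
    rw [add_sub_cancel] at h2
    show e.symm (φ (γ t)) = _
    rw [← h2, e.left_inv hmem]

end NullGeodesicCharts

end

theorem theorem4p3 {m : ℕ} {M : Type*} [TopologicalSpace M]
    [ChartedSpace (EuclideanSpace ℝ (Fin (m + 2))) M] [IsManifold (𝓡 (m + 2)) ∞ M]
    (g : LorentzianMetric (m + 2) M) (γ : ℝ → M) (D J : Set ℝ)
    (hγ : g.IsNullGeodesicOn γ D) (hJ : g.IsConjugatePointFreePortion γ D J)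
    (t₀ : ℝ) (ht₀ : t₀ ∈ J) :
    ∃ ψ : OpenPartialHomeomorph M (EuclideanSpace ℝ (Fin (m + 2))),
      g.IsNullCoordinateChart ψ ∧ γ t₀ ∈ ψ.source ∧ ψ (γ t₀) = 0 ∧
      IsMIntegralCurveOn γ (fun p ↦ coordField ψ 1 p)
        {t | t ∈ D ∧ γ '' uIcc t₀ t ⊆ ψ.source} := by
  obtain ⟨ψ, r, hψ, hp, hp0, htarget, hline⟩ :=
    hγ.exists_isNullCoordinateChart (hJ.subset ht₀)
  refine ⟨ψ, hψ, hp, hp0, hψ.1.isMIntegralCurveOn (t₀ := t₀)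
    (fun t ht ↦ ht.2 (mem_image_of_mem γ right_mem_uIcc)) fun t ht ↦ ?_⟩
  -- Having the whole interval from t₀ to t mapped into the chart excludes parameters at which γ has
  -- left the chart and come back.
  exact eq_smul_single_of_image_uIcc_subset hγ.ordConnected hγ.contMDiffOn.continuousOn
    (hJ.subset ht₀) (by simp) htarget hline ht.1 ht.2
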